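/- **Conventions.** Graphs are finite, simple and nonempty; a graph property $\mathcal P$ is an isomorphism-invariant class of graphs. It is *edge-monotone* if removing edges from a graph in $\mathcal P$ yields a graph in $\mathcal P$. A *witness* against $G\in\mathcal P$ is a nonempty induced subgraph $G'$ of $G$ such that no graph containing (a copy of) $G'$ as an induced subgraph has $\mathcal P$. The property $\mathcal P$ is *non-disjointed* if every graph without $\mathcal P$ contains a witness, and every witness $G'$ against $G\in\mathcal P$ has a connected induced subgraph $G''$ that is also a witness against $G\in\mathcal P$. A graph $G=(V,E)$ is *$\varepsilon$-far* from $\mathcal P$ if $G\notin\mathcal P$ and $|E\,\triangle\,E(H)|\ge\varepsilon|E|$ for every graph $H\in\mathcal P$ on the vertex set $V$. In the (randomized) CONGEST model the $n$ vertices of the network $G$ are processors with distinct IDs in $\{0,\dots,n^{\kappa}-1\}$, where $\kappa\ge 1$ is a fixed integer. Every processor knows $n$, its own ID and the IDs of its neighbours, and has a finite number (depending on $n$ and the algorithm) of private independent fair coin tosses. In each synchronous round every processor performs an arbitrary local computation and sends a (possibly empty) message of at most $B\lceil\log_2 n\rceil$ bits to each of its neighbours, where $B$ is a constant. A processor eventually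 stops and outputs ACCEPT or REJECT; the number of rounds is counted until all processors have stopped. $\mathcal P$ *can be verified in $O(\mathrm{diam}(G))$ rounds* if there are a CONGEST algorithm and a constant $c$ such that on every connected network $G$, for all ID assignments and all outcomes of the coin tosses (a deterministic algorithm uses none), all processors stop within $c\,(\mathrm{diam}(G)+1)$ rounds, and all of them accept if and only if $G\in\mathcal P$. A *one-sided $\varepsilon$-tester* for $\mathcal P$ is a randomized CONGEST algorithm such that on every network $G$ (connected or not), for every ID assignment: if $G\in\mathcal P$, then all processors accept, whatever the coin tosses; if $G$ is $\varepsilon$-far from $\mathcal P$, then with probability at least $2/3$ at least one processor rejects. **Theorem.** Let $\mathcal P$ be an edge-monotone, non-disjointed graph property that can be verified in the CONGEST model in $O(\mathrm{diam}(G))$ rounds. Then there are constants $C$ and $B$, depending only on $\mathcal P$ and $\kappa$, such that for every $\varepsilon>0$ there is a one-sided $\varepsilon$-tester for $\mathcal P$ in the randomized CONGEST model which uses messages of at most $B\lceil\log_2 n\rceil$ bits and in which all processors stop, on every network with $n$ processors and for all outcomes of the coin tosses, within $C\,(\log n)/\varepsilon$ rounds. -/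

import Mathlib

/-- A property of finite simple graphs, invariant under isomorphism. -/
structure GraphProperty where
  Holds : ∀ {V : Type} [Finite V], SimpleGraph V → Prop
  iso_invariant : ∀ {V W : Type} [Finite V] [Finite W] {G : SimpleGraph V} {H : SimpleGraph W},
    Nonempty (G ≃g H) → Holds G → Holds H

namespace GraphProperty

/-- Removing edges preserves the property. -/
def EdgeMonotone (P : GraphProperty) : Prop :=
  ∀ (V : Type) [Finite V] (G G' : SimpleGraph V), G' ≤ G → P.Holds G → P.Holds G'

/-- `W` is a witness against `P`: its presence as an induced subgraph certifies that a graph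
does not have `P`. -/
def IsWitness (P : GraphProperty) {U : Type} (W : SimpleGraph U) : Prop :=
  ∀ (V : Type) [Finite V] (H : SimpleGraph V), W.IsIndContained H → ¬ P.Holds H

/-- `P` is non-disjointed: inside every witness against `G ∈ P` there is a connected induced
subgraph that is again a witness. It is understood here that the failure of `P` is always
certified by a witness; this is the first field. Witnesses against `G ∈ P` are (nonempty)
induced subgraphs of `G`, given by their vertex sets. -/
structure NonDisjointed (P : GraphProperty) : Prop where
  exists_witness : ∀ (V : Type) [Finite V] [Nonempty V] (G : SimpleGraph V), ¬ P.Holds G →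
    ∃ U : Set V, U.Nonempty ∧ P.IsWitness (G.induce U)
  connected_witness : ∀ (V : Type) [Finite V] (G : SimpleGraph V) (U : Set V), U.Nonempty →
    P.IsWitness (G.induce U) →
    ∃ U' ⊆ U, (G.induce U').Connected ∧ P.IsWitness (G.induce U')

/-- `G` is `ε`-far from `P` in the general graph model: `G` does not have `P`, and at least
`ε |E(G)|` edges must be added or removed in order to obtain `P`. -/
def IsFar (P : GraphProperty) (ε : ℝ) {V : Type} [Finite V] (G : SimpleGraph V) : Prop :=
  ¬ P.Holds G ∧ ∀ H : SimpleGraph V, P.Holds H →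
    ε * (G.edgeSet.ncard : ℝ) ≤ ((symmDiff G.edgeSet H.edgeSet).ncard : ℝ)

end GraphProperty

/-- A synchronous message-passing algorithm for accepting or rejecting the network. Every
processor is given the number `n` of processors, its own ID, the IDs of its neighbours and
`coins n` private bits. Messages are natural numbers, read as bit strings through their binary
expansion; `0` is the empty message. A processor with `output s = some b` has stopped, with
verdict accept (`b = true`) or reject (`b = false`). -/
structure DistAlgorithm where
  State : Type
  coins : ℕ → ℕ
  init : (n : ℕ) → (ownId : ℕ) → (nbrIds : Finset ℕ) → (Fin (coins n) → Bool) → State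
  /-- The message that a processor sends to its neighbour with the given ID. -/
  send : State → (nbrId : ℕ) → ℕ
  /-- The update at the end of a round, from the messages received, indexed by sender ID. -/
  step : State → (inbox : ℕ → ℕ) → State
  output : State → Option Bool

/-- The processors have distinct IDs of `O(log n)` bits, namely from `{0, …, n ^ κ - 1}`. -/
def IsIdAssignment (κ : ℕ) {V : Type} [Fintype V] (ident : V → ℕ) : Prop :=
  Function.Injective ident ∧ ∀ v, ident v < Fintype.card V ^ κ

namespace DistAlgorithm

noncomputable section

/-- The message from a processor in state `s`; a processor that has stopped sends only empty
messages. -/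
def message (A : DistAlgorithm) (s : A.State) (nbrId : ℕ) : ℕ :=
  if (A.output s).isSome then 0 else A.send s nbrId

/-- Outcomes of all private coin tosses in a network with processor set `V`. -/
abbrev Coins (A : DistAlgorithm) (V : Type) [Fintype V] : Type :=
  V → Fin (A.coins (Fintype.card V)) → Bool

open Classical in
/-- The state of every processor after `t` rounds, for given outcomes `ω` of the coin tosses.
A processor that has stopped keeps its state. -/
def stateAt (A : DistAlgorithm) {V : Type} [Fintype V] (G : SimpleGraph V) (ident : V → ℕ)
    (ω : A.Coins V) : ℕ → V → A.State
  | 0, v => A.init (Fintype.card V) (ident v) ((G.neighborFinset v).image ident) (ω v)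
  | t + 1, v =>
    if (A.output (A.stateAt G ident ω t v)).isSome then A.stateAt G ident ω t v
    else A.step (A.stateAt G ident ω t v)
      (Function.extend (fun u : G.neighborSet v => ident u)
        (fun u => A.message (A.stateAt G ident ω t u) (ident v)) (fun _ => 0))

/-- The verdict of `v` after `t` rounds; `none` if `v` is still running. -/
def verdict (A : DistAlgorithm) {V : Type} [Fintype V] (G : SimpleGraph V) (ident : V → ℕ)
    (ω : A.Coins V) (t : ℕ) (v : V) : Option Bool :=
  A.output (A.stateAt G ident ω t v)

/-- All messages have at most `B ⌈log₂ n⌉` bits. -/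
def RespectsBandwidth (A : DistAlgorithm) (B : ℕ) {V : Type} [Fintype V] (G : SimpleGraph V)
    (ident : V → ℕ) : Prop :=
  ∀ (ω : A.Coins V) (t : ℕ) (u v : V), G.Adj u v →
    (A.message (A.stateAt G ident ω t u) (ident v)).size ≤ B * Nat.clog 2 (Fintype.card V)

/-- All processors have stopped after at most `T` rounds, whatever the coin tosses. -/
def HaltsWithin (A : DistAlgorithm) (T : ℕ) {V : Type} [Fintype V] (G : SimpleGraph V)
    (ident : V → ℕ) : Prop :=
  ∀ (ω : A.Coins V) (v : V), (A.verdict G ident ω T v).isSome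

/-- The final verdict of `v` is `b`. -/
def Outputs (A : DistAlgorithm) {V : Type} [Fintype V] (G : SimpleGraph V) (ident : V → ℕ)
    (ω : A.Coins V) (v : V) (b : Bool) : Prop :=
  ∃ t, A.verdict G ident ω t v = some b

open Classical in
/-- The probability, over independent fair coins, that at least one processor rejects. -/
def rejectProb (A : DistAlgorithm) {V : Type} [Fintype V] (G : SimpleGraph V)
    (ident : V → ℕ) : ℝ :=
  (Fintype.card {ω : A.Coins V // ∃ v, A.Outputs G ident ω v false} : ℝ) /
    (Fintype.card (A.Coins V) : ℝ)

end

end DistAlgorithm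

/-- `P` can be verified in the CONGEST model (IDs below `n ^ κ`) in `O(diam G)` rounds: on every
connected network all processors stop within `c (diam G + 1)` rounds, and all of them accept if
and only if the network has `P`. The verifier never errs; it is deterministic when it uses
no coins. -/
def VerifiableInDiameterRounds (κ : ℕ) (P : GraphProperty) : Prop :=
  ∃ (A : DistAlgorithm) (B c : ℕ),
    ∀ (V : Type) [Fintype V] (G : SimpleGraph V) (ident : V → ℕ),
      G.Connected → IsIdAssignment κ ident →
        A.RespectsBandwidth B G ident ∧
        A.HaltsWithin (c * (G.diam + 1)) G ident ∧
        ∀ ω : A.Coins V, (∀ v, A.Outputs G ident ω v true) ↔ P.Holds G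

/-- `A` is a one-sided `ε`-tester for `P` in the randomized CONGEST model (IDs below `n ^ κ`),
with messages of at most `B ⌈log₂ n⌉` bits and at most `T n` rounds on networks with `n`
processors. -/
structure IsOneSidedTester (κ : ℕ) (P : GraphProperty) (ε : ℝ) (B : ℕ) (T : ℕ → ℝ)
    (A : DistAlgorithm) : Prop where
  bandwidth : ∀ (V : Type) [Fintype V] (G : SimpleGraph V) (ident : V → ℕ),
    IsIdAssignment κ ident → A.RespectsBandwidth B G ident
  rounds : ∀ (V : Type) [Fintype V] [Nonempty V] (G : SimpleGraph V) (ident : V → ℕ),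
    IsIdAssignment κ ident →
      ∃ t : ℕ, (t : ℝ) ≤ T (Fintype.card V) ∧ A.HaltsWithin t G ident
  complete : ∀ (V : Type) [Fintype V] (G : SimpleGraph V) (ident : V → ℕ),
    IsIdAssignment κ ident → P.Holds G → ∀ (ω : A.Coins V) (v : V), A.Outputs G ident ω v true
  sound : ∀ (V : Type) [Fintype V] [Nonempty V] (G : SimpleGraph V) (ident : V → ℕ),
    IsIdAssignment κ ident → P.IsFar ε G → 2 / 3 ≤ A.rejectProb G ident

/-! The tester cuts the network into clusters of diameter O((log n)/ε) with few edges between them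
and runs the verifier inside all clusters at once.

Clustering by random shifts: each vertex `u` draws a geometric shift `y u` with parameter p = 2⁻ᵏ of
order ε and starts flooding at time `K - y u`, where K is of order (log n)/p. So `v` joins a cluster
whose center maximises `y u - dist u v`. If the maximum leads by 3 (`HasGap`), all neighbours of `v`
get the same center (`IsClustering.center_eq_of_hasGap`). Raising the maximal value by 3 injects
configurations into those with a gap and scales their weight by (1 - p)³. Hence, up to truncation, a
gap is missing with probability at most 6p (`sum_not_hasGap_geometric_le`). As 36p ≤ ε, Markov's
inequality leaves fewer than ε|E| cut edges with probability at least 2/3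
(`two_thirds_le_card_shifts`).

Soundness: if `G` is far from `P`, deleting so few cut edges cannot produce `P`. The remaining graph
contains a connected witness, which lies in a single cluster, so that cluster fails `P`
(`NonDisjointed.exists_cluster`) and one of its vertices rejects. Completeness: `P` passes to
induced subgraphs (`NonDisjointed.holds_induce`), so on a graph with `P` every cluster accepts,
whatever the coins.

The verifier is only guaranteed to work with IDs that are polynomial in the size of its own network.
Each cluster therefore counts and renumbers its vertices in preorder along its flooding tree before
the simulation (`IsForest`, `Clustered.nodeAt_inner_eq`). -/

open Finset

/-! ### Geometric shifts rarely lack a gap -/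

/-- The shifted values `y u - D u` have a maximum that beats all others by at least `3`. -/
def HasGap {V : Type} (D y : V → ℕ) : Prop :=
  ∃ u, ∀ u', u' ≠ u → y u' + D u + 3 ≤ y u + D u'

section Gap

variable {V : Type} [Fintype V] [Nonempty V]

theorem exists_top (D y : V → ℕ) : ∃ u, ∀ u', y u' + D u ≤ y u + D u' := by
  obtain ⟨u, hu⟩ := Finite.exists_max (fun u => (y u : ℤ) - D u)
  exact ⟨u, fun u' => by have := hu u'; omega⟩

variable [DecidableEq V]

/-- Raise the maximal shifted value by `3`. -/
noncomputable def raiseTop (D y : V → ℕ) : V → ℕ :=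
  Function.update y (exists_top D y).choose (y (exists_top D y).choose + 3)

theorem raiseTop_spec (D y : V → ℕ) : ∃ u, raiseTop D y = Function.update y u (y u + 3) ∧
    ∀ u', u' ≠ u → raiseTop D y u' + D u + 3 ≤ raiseTop D y u + D u' := by
  refine ⟨_, rfl, fun u' hu' => ?_⟩
  have := (exists_top D y).choose_spec u'
  simp only [raiseTop, Function.update_self, Function.update_of_ne hu']
  omega

theorem hasGap_raiseTop (D y : V → ℕ) : HasGap D (raiseTop D y) :=
  let ⟨u, _, h⟩ := raiseTop_spec D y
  ⟨u, h⟩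

/-- The raised coordinate can be read off from the result, since only one coordinate can lead all
others by 3. Subtracting 3 there recovers the original. -/
theorem raiseTop_injective (D : V → ℕ) : Function.Injective (raiseTop D) := by
  intro y y' h
  obtain ⟨u, hu, hg⟩ := raiseTop_spec D y
  obtain ⟨u', hu', hg'⟩ := raiseTop_spec D y'
  have huu : u = u' := by
    by_contra hne
    have h1 := hg u' (Ne.symm hne)
    have h2 := hg' u hne
    rw [h] at h1
    omega
  subst huu
  funext v
  have hv : raiseTop D y v = raiseTop D y' v := by rw [h]
  rw [hu, hu'] at hv
  by_cases hvu : v = u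
  · subst hvu; simpa using hv
  · simpa [Function.update_of_ne hvu] using hv

open Classical in
/-- If the weight decays by the factor `r` along every step of length `3`, then the configurations
without a gap have small total weight. -/
theorem sum_not_hasGap_le (D : V → ℕ) (w : ℕ → ℝ) (r : ℝ) (M : ℕ) (hw : ∀ j, 0 ≤ w j)
    (hr : ∀ j < M, w (j + 3) = r * w j) :
    ∑ y ∈ (Fintype.piFinset fun _ : V => range (M + 3)) with ¬ HasGap D y, ∏ u, w (y u) ≤
      (∑ j ∈ range (M + 3), w j) ^ Fintype.card V -
        r * (∑ j ∈ range M, w j) ^ Fintype.card V := by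
  have key : ∀ N, (∑ j ∈ range N, w j) ^ Fintype.card V =
      ∑ y ∈ (Fintype.piFinset fun _ : V => range N), ∏ u, w (y u) := by
    intro N
    rw [← Finset.prod_univ_sum]
    simp
  rw [key, key, le_sub_iff_add_le,
    ← Finset.sum_filter_add_sum_filter_not (Fintype.piFinset fun _ : V => range (M + 3))
      (fun y => HasGap D y), add_comm]
  gcongr
  -- It remains to find weight r · (total over the box of side `M`) among the configurations with a
  -- gap. `raiseTop` provides it: it maps that box injectively into the box of side `M + 3` and
  -- multiplies each weight by `r`.
  rw [Finset.mul_sum]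
  have : ∀ y ∈ (Fintype.piFinset fun _ : V => range M),
      r * ∏ u, w (y u) = ∏ u, w (raiseTop D y u) := by
    intro y hy
    obtain ⟨u, hu, -⟩ := raiseTop_spec D y
    rw [hu, ← Finset.mul_prod_erase univ _ (mem_univ u),
      ← Finset.mul_prod_erase univ (fun v => w (Function.update y u (y u + 3) v)) (mem_univ u),
      Function.update_self, hr _ (by simpa using Fintype.mem_piFinset.1 hy u), mul_assoc]
    congr 2
    refine Finset.prod_congr rfl fun v hv => ?_
    rw [Function.update_of_ne (Finset.ne_of_mem_erase hv)]
  rw [Finset.sum_congr rfl this, ← Finset.sum_image (f := fun y => ∏ u, w (y u))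
    (fun y _ y' _ h => raiseTop_injective D h)]
  refine Finset.sum_le_sum_of_subset_of_nonneg ?_ fun y _ _ => Finset.prod_nonneg fun u _ => hw _
  intro z hz
  obtain ⟨y, hy, rfl⟩ := Finset.mem_image.1 hz
  refine Finset.mem_filter.2 ⟨Fintype.mem_piFinset.2 fun v => ?_, hasGap_raiseTop D y⟩
  obtain ⟨u, hu, -⟩ := raiseTop_spec D y
  have h := fun v => Finset.mem_range.1 (Fintype.mem_piFinset.1 hy v)
  rw [hu, Finset.mem_range]
  by_cases hvu : v = u
  · subst hvu; simpa using h v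
  · rw [Function.update_of_ne hvu]; have := h v; omega

/-- The geometric weights `p (1 - p) ^ j`. -/
theorem sum_not_hasGap_geometric_le (D : V → ℕ) (p : ℝ) (hp0 : 0 ≤ p) (hp1 : p ≤ 1) (M : ℕ)
    (hM : Fintype.card V * (1 - p) ^ M ≤ 1) [DecidablePred (HasGap D)] :
    ∑ y ∈ (Fintype.piFinset fun _ : V => range (M + 3)) with ¬ HasGap D y,
      ∏ u, (p * (1 - p) ^ y u) ≤ 6 * p := by
  set x := 1 - p with hx
  have hx0 : 0 ≤ x := by linarith
  have hx1 : x ≤ 1 := by linarith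
  have hsum : ∀ N, ∑ j ∈ range N, p * x ^ j = 1 - x ^ N := by
    intro N
    rw [← Finset.mul_sum]
    have := geom_sum_mul_neg x N
    rw [← this, hx]; ring
  have h1 := sum_not_hasGap_le D (fun j => p * x ^ j) (x ^ 3) M (fun j => by positivity)
    (fun j _ => by ring)
  rw [hsum, hsum] at h1
  have hb0 : 0 ≤ 1 - x ^ M := by linarith [pow_le_one₀ hx0 hx1 (n := M)]
  have hb1 : 1 - x ^ M ≤ 1 := by linarith [pow_nonneg hx0 M]
  have ha1 : 1 - x ^ (M + 3) ≤ 1 := by linarith [pow_nonneg hx0 (M + 3)]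
  have hba : 1 - x ^ M ≤ 1 - x ^ (M + 3) := by
    linarith [pow_le_pow_of_le_one hx0 hx1 (Nat.le_add_right M 3)]
  -- With n = |V|, a = 1 - x^(M+3), b = 1 - x^M, the bound aⁿ - x³bⁿ is (aⁿ - bⁿ) + (1 - x³)bⁿ. The
  -- first term is at most n(a - b) = n x^M (1 - x³), so by `hM` both are at most 1 - x³ ≤ 3p. This
  -- gives 6p.
  have hdiff : (1 - x ^ (M + 3)) ^ Fintype.card V - (1 - x ^ M) ^ Fintype.card V ≤
      Fintype.card V * ((1 - x ^ (M + 3)) - (1 - x ^ M)) := by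
    generalize 1 - x ^ (M + 3) = a at *
    generalize 1 - x ^ M = b at *
    generalize Fintype.card V = n
    induction n with
    | zero => simp
    | succ n ih =>
      have e1 : a ^ (n + 1) - b ^ (n + 1) = a * (a ^ n - b ^ n) + (a - b) * b ^ n := by ring
      have e2 : a * (a ^ n - b ^ n) ≤ 1 * (a ^ n - b ^ n) := by
        have : 0 ≤ a ^ n - b ^ n := sub_nonneg.2 (pow_le_pow_left₀ hb0 hba n)
        gcongr
      have e3 : (a - b) * b ^ n ≤ (a - b) * 1 := by
        have : 0 ≤ a - b := by linarith
        gcongr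
        exact pow_le_one₀ hb0 hb1
      push_cast
      nlinarith
  have hq : (1 - x ^ M) ^ Fintype.card V ≤ 1 := pow_le_one₀ hb0 hb1
  have hx3 : 0 ≤ 1 - x ^ 3 := by linarith [pow_le_one₀ hx0 hx1 (n := 3)]
  have hx3' : 1 - x ^ 3 ≤ 3 * p := by
    rw [hx]
    nlinarith [mul_nonneg hp0 hp0, mul_nonneg hp0 (mul_nonneg hp0 hp0)]
  have e4 : Fintype.card V * ((1 - x ^ (M + 3)) - (1 - x ^ M)) =
      (Fintype.card V * x ^ M) * (1 - x ^ 3) := by ring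
  have e5 : (Fintype.card V * x ^ M) * (1 - x ^ 3) ≤ 1 * (1 - x ^ 3) := by gcongr
  have e6 : (1 - x ^ 3) * (1 - x ^ M) ^ Fintype.card V ≤ (1 - x ^ 3) * 1 := by gcongr
  have h2 : ∑ y ∈ (Fintype.piFinset fun _ : V => range (M + 3)) with ¬ HasGap D y,
      ∏ u, (p * x ^ y u) ≤ (1 - x ^ (M + 3)) ^ Fintype.card V -
        x ^ 3 * (1 - x ^ M) ^ Fintype.card V := by
    convert h1
  nlinarith

end Gap

/-! ### Geometric shifts from fair coins, and the number of edges without a gap -/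

/-- Fair coins can produce a geometric random variable with success probability `2⁻ᵏ`, truncated
at `K`. -/
theorem exists_geometric_coins (k K : ℕ) :
    ∃ δ : (Fin (k * K) → Bool) → ℕ, ∀ j < K,
      (((univ.filter fun a => δ a = j).card : ℕ) : ℝ) =
        2 ^ (k * K) * ((2 ^ k : ℝ)⁻¹ * (1 - (2 ^ k : ℝ)⁻¹) ^ j) := by
  have hq : 1 ≤ 2 ^ k := Nat.one_le_two_pow
  generalize hqd : 2 ^ k = q at hq
  -- `cnt j` is the number of strings of `K` digits in base q = 2ᵏ whose first zero is at position
  -- `j`; the value `K` collects the strings without a zero. The counts add up to q^K, so any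
  -- bijection with the coin outcomes yields the distribution.
  set cnt : ℕ → ℕ := fun j => if j < K then (q - 1) ^ j * q ^ (K - 1 - j) else (q - 1) ^ K with hcnt
  have hsum : ∀ j ≤ K, ∑ i ∈ range j, cnt i + (q - 1) ^ j * q ^ (K - j) = q ^ K := by
    intro j hj
    induction j with
    | zero => simp
    | succ j ih =>
      rw [Finset.sum_range_succ, ← ih (by omega), add_assoc]
      congr 1
      have : cnt j = (q - 1) ^ j * q ^ (K - 1 - j) := by simp [hcnt, show j < K by omega]
      rw [this, show K - (j + 1) = K - 1 - j by omega, show K - j = K - 1 - j + 1 by omega,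
        pow_succ, pow_succ]
      obtain ⟨m, rfl⟩ : ∃ m, q = m + 1 := ⟨q - 1, by omega⟩
      simp only [Nat.add_sub_cancel]; ring
  have hcard : Fintype.card (Fin (k * K) → Bool) =
      Fintype.card (Σ j : Fin (K + 1), Fin (cnt j)) := by
    have h := hsum K le_rfl
    simp only [Fintype.card_pi, Fintype.card_bool, Finset.prod_const, Finset.card_univ,
      Fintype.card_fin, Fintype.card_sigma]
    rw [Fin.sum_univ_eq_sum_range cnt, Finset.sum_range_succ, pow_mul, hqd, ← h]
    simp [hcnt]
  let e := Fintype.equivOfCardEq hcard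
  refine ⟨fun a => (e a).1, fun j hj => ?_⟩
  have hf : (univ.filter fun a => ((e a).1 : ℕ) = j).card = cnt j := by
    rw [← Fintype.card_fin (cnt j), ← Finset.card_univ]
    symm
    refine Finset.card_bij (fun x _ => e.symm ⟨⟨j, by omega⟩, x⟩) ?_ ?_ ?_
    · intro x _; simp
    · intro x _ y _ h; simpa using h
    · intro a ha
      have ha : ((e a).1 : ℕ) = j := by simpa using ha
      subst ha
      exact ⟨(e a).2, mem_univ _, by simp⟩
  rw [hf]
  have hq0 : (q : ℝ) ≠ 0 := by positivity
  have hq' : (2 ^ k : ℝ) = q := by rw [← hqd]; push_cast; rfl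
  simp only [hcnt, if_pos hj]
  rw [pow_mul, hq']
  push_cast [Nat.cast_sub hq]
  rw [show (1 - (q : ℝ)⁻¹) = (q - 1) / q by field_simp, div_pow,
    show (q : ℝ) ^ K = q ^ (K - 1 - j) * q ^ j * q by rw [← pow_add, ← pow_succ]; congr 1; omega]
  field_simp

/-- The distribution of independent discrete random variables. -/
theorem card_filter_comp {V A : Type} [Fintype V] [DecidableEq V] [Fintype A] (δ : A → ℕ) (K : ℕ)
    (Q : (V → ℕ) → Prop) [DecidablePred Q] (t : ℝ) (w : ℕ → ℝ)
    [DecidablePred fun ω : V → A => (∀ u, δ (ω u) < K) ∧ Q (δ ∘ ω)]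
    (hw : ∀ j < K, ((univ.filter fun a => δ a = j).card : ℝ) = t * w j) :
    ((univ.filter fun ω : V → A => (∀ u, δ (ω u) < K) ∧ Q (δ ∘ ω)).card : ℝ) =
      t ^ Fintype.card V * ∑ y ∈ (Fintype.piFinset fun _ : V => range K) with Q y,
        ∏ u, w (y u) := by
  rw [Finset.card_eq_sum_card_fiberwise (f := fun ω : V → A => δ ∘ ω)
    (t := (Fintype.piFinset fun _ : V => range K).filter Q)]
  · push_cast
    rw [Finset.mul_sum]
    refine Finset.sum_congr rfl fun y hy => ?_
    rw [Finset.mem_filter, Fintype.mem_piFinset] at hy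
    have : (univ.filter fun ω : V → A => (∀ u, δ (ω u) < K) ∧ Q (δ ∘ ω)).filter
        (fun ω => δ ∘ ω = y) = Fintype.piFinset fun u => univ.filter fun a => δ a = y u := by
      ext ω
      simp only [Finset.mem_filter, mem_univ, true_and, Fintype.mem_piFinset]
      constructor
      · rintro ⟨-, rfl⟩ u; rfl
      · intro h
        have h' : δ ∘ ω = y := funext h
        refine ⟨⟨fun u => ?_, h' ▸ hy.2⟩, h'⟩
        rw [h u]; simpa using hy.1 u
    rw [this, Fintype.card_piFinset]
    push_cast
    rw [Finset.prod_congr rfl fun u _ => hw (y u) (by simpa using hy.1 u), Finset.prod_mul_distrib]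
    simp
  · intro ω hω
    simp only [Finset.coe_filter, mem_univ, true_and, Set.mem_ofPred_eq] at hω
    simp only [Finset.coe_filter, Set.mem_ofPred_eq, Fintype.mem_piFinset, Finset.mem_range]
    exact hω

/-- Since (1 - 1/q)^q ≤ e⁻¹ ≤ 1/2 for q = 2ᵏ, the power is at most 2^(-clog n - 3) ≤ 1/(8n). By a
union bound, some shift is truncated with probability at most 1/8. -/
theorem card_mul_one_sub_pow_le (n k : ℕ) :
    (n : ℝ) * (1 - (2 ^ k : ℝ)⁻¹) ^ (2 ^ k * (Nat.clog 2 n + 3)) ≤ 1 / 8 := by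
  have hq : (1 : ℝ) ≤ 2 ^ k := one_le_pow₀ (by norm_num)
  have h1 : (1 - (2 ^ k : ℝ)⁻¹) ^ (2 ^ k) ≤ 1 / 2 := by
    have h := Real.one_sub_div_pow_le_exp_neg (n := 2 ^ k) (t := 1) (by exact_mod_cast hq)
    have h2 : Real.exp (-1) ≤ 1 / 2 := by
      rw [Real.exp_neg, ← one_div]
      have := Real.add_one_le_exp (1 : ℝ)
      gcongr
      linarith
    push_cast at h
    rw [one_div] at h
    exact h.trans h2
  have h0 : 0 ≤ 1 - (2 ^ k : ℝ)⁻¹ := by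
    have := inv_le_one_of_one_le₀ hq
    linarith
  have hn : (n : ℝ) ≤ 2 ^ Nat.clog 2 n := by exact_mod_cast Nat.le_pow_clog one_lt_two n
  calc (n : ℝ) * (1 - (2 ^ k : ℝ)⁻¹) ^ (2 ^ k * (Nat.clog 2 n + 3))
      = n * ((1 - (2 ^ k : ℝ)⁻¹) ^ (2 ^ k)) ^ (Nat.clog 2 n + 3) := by rw [pow_mul]
    _ ≤ 2 ^ Nat.clog 2 n * (1 / 2) ^ (Nat.clog 2 n + 3) := by gcongr
    _ = 1 / 8 := by
      rw [pow_add, ← mul_assoc, ← mul_pow]; norm_num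

open Classical in
/-- With probability at least `2 / 3`, no random shift is truncated and less than an `ε`-fraction
of the indices in `E` fail to have a gap. -/
theorem two_thirds_le_card_shifts {V ι : Type} [Fintype V] [Nonempty V] (ε : ℝ)
    (k M : ℕ) (hk : 36 ≤ ε * 2 ^ k)
    (hM : M = 2 ^ k * (Nat.clog 2 (Fintype.card V) + 3))
    {A : Type} [Fintype A] (hA : (Fintype.card A : ℝ) = 2 ^ (k * (M + 3))) (δ : A → ℕ)
    (hδ : ∀ j < M + 3, (((univ.filter fun a => δ a = j).card : ℕ) : ℝ) =
        2 ^ (k * (M + 3)) * ((2 ^ k : ℝ)⁻¹ * (1 - (2 ^ k : ℝ)⁻¹) ^ j))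
    (E : Finset ι) (hE : E.Nonempty) (D : ι → V → ℕ) :
    2 / 3 * (Fintype.card (V → A) : ℝ) ≤
      ((univ.filter fun ω : V → A => (∀ u, δ (ω u) < M + 3) ∧
        ((E.filter fun e => ¬ HasGap (D e) (δ ∘ ω)).card : ℝ) < ε * E.card).card : ℝ) := by
  set p : ℝ := (2 ^ k : ℝ)⁻¹ with hp
  have hq : (1 : ℝ) ≤ 2 ^ k := one_le_pow₀ (by norm_num)
  have hp0 : 0 < p := by positivity
  have hp1 : p ≤ 1 := inv_le_one_of_one_le₀ hq
  -- 36 = 6 · 6: an index lacks a gap with probability at most 6p ≤ ε/6, and Markov's inequality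
  -- then costs 1/6.
  have hpε : 36 * p ≤ ε := by
    have : p * 2 ^ k = 1 := inv_mul_cancel₀ (by positivity)
    nlinarith
  set N : ℝ := (2 ^ (k * (M + 3))) ^ Fintype.card V with hN
  have hN0 : 0 < N := by positivity
  have hcard : (Fintype.card (V → A) : ℝ) = N := by simp [hN, hA]
  have hE0 : (0 : ℝ) < E.card := by exact_mod_cast hE.card_pos
  have hnM : Fintype.card V * (1 - p) ^ M ≤ 1 / 8 := by
    rw [hM]; exact card_mul_one_sub_pow_le _ _
  have hx0 : 0 ≤ 1 - p := by linarith
  -- truncation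
  set S : Finset (V → A) := univ.filter fun ω => ∀ u, δ (ω u) < M + 3 with hS
  have hgood : 7 / 8 * N ≤ S.card := by
    have h := card_filter_comp (V := V) δ (M + 3) (fun _ => True) _ _ hδ
    simp only [and_true, filter_true] at h
    rw [← Finset.prod_univ_sum (fun _ : V => range (M + 3)) (fun _ j => p * (1 - p) ^ j)] at h
    rw [hS, h, ← hN, mul_comm]
    gcongr
    have hsum : ∑ j ∈ range (M + 3), p * (1 - p) ^ j = 1 - (1 - p) ^ (M + 3) := by
      rw [← Finset.mul_sum]
      have := geom_sum_mul_neg (1 - p) (M + 3)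
      rw [← this]; ring
    rw [Finset.prod_const, hsum, Finset.card_univ]
    have hle : (1 - p) ^ (M + 3) ≤ (1 - p) ^ M :=
      pow_le_pow_of_le_one hx0 (by linarith) (by omega)
    have hle1 : (1 - p) ^ (M + 3) ≤ 1 := pow_le_one₀ hx0 (by linarith)
    -- Bernoulli's inequality plays the part of the union bound over the vertices.
    have hb := one_add_mul_le_pow (a := -(1 - p) ^ (M + 3)) (by linarith) (Fintype.card V)
    rw [← sub_eq_add_neg] at hb
    have : (Fintype.card V : ℝ) * (1 - p) ^ (M + 3) ≤ Fintype.card V * (1 - p) ^ M := by gcongr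
    linarith
  -- Markov's inequality
  have hbad : ((S.filter fun ω => ε * E.card ≤
      ((E.filter fun e => ¬ HasGap (D e) (δ ∘ ω)).card : ℝ)).card : ℝ) ≤ 1 / 6 * N := by
    have h1 : ε * E.card * ((S.filter fun ω => ε * E.card ≤
        ((E.filter fun e => ¬ HasGap (D e) (δ ∘ ω)).card : ℝ)).card : ℝ) ≤
        ∑ ω ∈ S, ((E.filter fun e => ¬ HasGap (D e) (δ ∘ ω)).card : ℝ) := by
      rw [mul_comm, ← nsmul_eq_mul]
      refine (Finset.card_nsmul_le_sum _ _ _ fun ω hω => (Finset.mem_filter.1 hω).2).trans ?_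
      exact Finset.sum_le_sum_of_subset_of_nonneg (Finset.filter_subset _ _)
        fun _ _ _ => by positivity
    have h2 : ∑ ω ∈ S, ((E.filter fun e => ¬ HasGap (D e) (δ ∘ ω)).card : ℝ) ≤
        E.card * (6 * p * N) := by
      have : ∑ ω ∈ S, ((E.filter fun e => ¬ HasGap (D e) (δ ∘ ω)).card : ℝ) =
          ∑ e ∈ E, ((S.filter fun ω => ¬ HasGap (D e) (δ ∘ ω)).card : ℝ) := by
        exact_mod_cast Finset.sum_card_bipartiteAbove_eq_sum_card_bipartiteBelow _
      rw [this, ← nsmul_eq_mul]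
      refine Finset.sum_le_card_nsmul _ _ _ fun e _ => ?_
      have h := card_filter_comp (V := V) δ (M + 3) (fun y => ¬ HasGap (D e) y) _ _ hδ
      rw [hS, Finset.filter_filter, h, ← hN, mul_comm]
      gcongr
      exact sum_not_hasGap_geometric_le (D e) p hp0.le hp1 M (by linarith)
    have h3 := h1.trans h2
    have h4 : (E.card : ℝ) * (6 * p * N) ≤ ε * E.card * (1 / 6 * N) := by
      have := mul_le_mul_of_nonneg_left hpε (mul_pos hE0 hN0).le
      nlinarith
    exact le_of_mul_le_mul_left (h3.trans h4) (mul_pos (by linarith) hE0)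
  have hsplit := Finset.card_filter_add_card_filter_not (s := S) (fun ω => ε * E.card ≤
      ((E.filter fun e => ¬ HasGap (D e) (δ ∘ ω)).card : ℝ))
  have hset : (S.filter fun ω => ¬ ε * E.card ≤
      ((E.filter fun e => ¬ HasGap (D e) (δ ∘ ω)).card : ℝ)) =
      univ.filter fun ω : V → A => (∀ u, δ (ω u) < M + 3) ∧
        ((E.filter fun e => ¬ HasGap (D e) (δ ∘ ω)).card : ℝ) < ε * E.card := by
    rw [hS, Finset.filter_filter]
    simp only [not_le]
  rw [hset] at hsplit
  rw [hcard]
  have : ((S.filter fun ω => ε * E.card ≤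
      ((E.filter fun e => ¬ HasGap (D e) (δ ∘ ω)).card : ℝ)).card : ℝ) +
      ((univ.filter fun ω : V → A => (∀ u, δ (ω u) < M + 3) ∧
        ((E.filter fun e => ¬ HasGap (D e) (δ ∘ ω)).card : ℝ) < ε * E.card).card : ℝ) = S.card := by
    exact_mod_cast hsplit
  -- 7/8 - 1/6 = 17/24 ≥ 2/3.
  linarith

/-! ### Rooted forests, subtree sizes and preorder numbers -/

/-- A rooted spanning forest whose trees are the colour classes of `center`. -/
structure IsForest {V : Type} (center : V → ℕ) (par : V → Option V) (level : V → ℕ) (L : ℕ) :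
    Prop where
  center_par : ∀ {v w}, par v = some w → center w = center v
  level_par : ∀ {v w}, par v = some w → level w + 1 = level v
  root_unique : ∀ {v w}, par v = none → par w = none → center v = center w → v = w
  level_le : ∀ v, level v ≤ L

namespace IsForest

variable {V : Type} {center : V → ℕ} {par : V → Option V} {level : V → ℕ} {L : ℕ}

theorem exists_root (hF : IsForest center par level L) (v : V) :
    ∃ r, par r = none ∧ center r = center v ∧ level r ≤ level v ∧ (level r = level v → r = v) := by
  induction h : level v using Nat.strong_induction_on generalizing v with
  | _ l ih =>
    subst h
    rcases hp : par v with _ | w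
    · exact ⟨v, hp, rfl, le_rfl, fun _ => rfl⟩
    · have hl := hF.level_par hp
      obtain ⟨r, h1, h2, h3, -⟩ := ih (level w) (by omega) w rfl
      exact ⟨r, h1, h2.trans (hF.center_par hp), by omega, fun h => by omega⟩

theorem level_root_lt (hF : IsForest center par level L) {r v : V} (hr : par r = none)
    (hc : center r = center v) (hne : r ≠ v) : level r < level v := by
  obtain ⟨r', h1, h2, h3, h4⟩ := hF.exists_root v
  obtain rfl := hF.root_unique hr h1 (hc.trans h2.symm)
  exact lt_of_le_of_ne h3 fun h => hne (h4 h)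

variable [Fintype V] [DecidableEq V]

/-- Sizes of subtrees. -/
theorem exists_size (hF : IsForest center par level L) :
    ∃ s : V → ℕ, ∀ v, s v = 1 + ∑ u with par u = some v, s u := by
  -- The recursion runs from the leaves to the root; the bound `L` on the levels makes it
  -- well-founded.
  have hdec : ∀ {u v}, par u = some v → L - level u < L - level v := fun {u v} h => by
    have := hF.level_par h
    have := hF.level_le u
    omega
  let F : (v : V) → ((u : V) → L - level u < L - level v → ℕ) → ℕ := fun v ih =>
    1 + ∑ u ∈ (univ.filter fun u => par u = some v).attach,
      ih u.1 (hdec (Finset.mem_filter.1 u.2).2)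
  refine ⟨(measure fun v => L - level v).wf.fix F, fun v => ?_⟩
  rw [WellFounded.fix_eq]
  simp only [F]
  congr 1
  exact Finset.sum_attach (univ.filter fun u => par u = some v)
    (fun u => (measure fun v => L - level v).wf.fix F u)

/-- Preorder numbers of the vertices. -/
theorem exists_label (hF : IsForest center par level L) (ident s : V → ℕ) :
    ∃ a : V → ℕ, (∀ v, par v = none → a v = 0) ∧ ∀ v w, par v = some w →
      a v = a w + 1 + ∑ u with par u = some w ∧ ident u < ident v, s u := by
  have hdec : ∀ {v w}, par v = some w → level w < level v := fun {v w} h => by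
    have := hF.level_par h
    omega
  let F : (v : V) → ((u : V) → level u < level v → ℕ) → ℕ := fun v ih =>
    match h : par v with
    | none => 0
    | some w => ih w (hdec h) + 1 + ∑ u with par u = some w ∧ ident u < ident v, s u
  refine ⟨(measure level).wf.fix F, fun v hv => ?_, fun v w hv => ?_⟩
  · rw [WellFounded.fix_eq]
    simp only [F]
    split
    · rfl
    · simp_all
  · rw [WellFounded.fix_eq]
    simp only [F]
    split
    · simp_all
    · next w' h =>
      obtain rfl : w = w' := by simpa [hv] using h
      rfl

variable {s a ident : V → ℕ}

/-- Summed over the tree, the recursion for `s` contains every vertex except the root exactly once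
as a child. All terms but `s r` cancel, leaving the number of vertices. -/
theorem size_root (hF : IsForest center par level L)
    (hs : ∀ v, s v = 1 + ∑ u with par u = some v, s u) {r : V} (hr : par r = none) :
    s r = (univ.filter fun v => center v = center r).card := by
  set C := univ.filter fun v => center v = center r with hC
  have h1 : ∑ v ∈ C, s v = C.card + ∑ v ∈ C, ∑ u with par u = some v, s u := by
    rw [Finset.sum_congr rfl fun v _ => hs v, Finset.sum_add_distrib]
    simp
  have h2 : ∑ v ∈ C, ∑ u with par u = some v, s u = ∑ u ∈ C.erase r, s u := by
    rw [Finset.sum_sigma']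
    refine Finset.sum_bij (fun x _ => x.2) ?_ ?_ ?_ ?_
    · rintro ⟨v, u⟩ hx
      simp only [Finset.mem_sigma, Finset.mem_filter, mem_univ, true_and, hC] at hx
      simp only [Finset.mem_erase, hC, Finset.mem_filter, mem_univ, true_and]
      refine ⟨?_, (hF.center_par hx.2).symm.trans hx.1⟩
      rintro rfl
      simp [hr] at hx
    · rintro ⟨v, u⟩ hx ⟨v', u'⟩ hx' h
      simp only [Finset.mem_sigma, Finset.mem_filter, mem_univ, true_and] at hx hx' h
      subst h
      obtain rfl : v = v' := by simpa [hx.2] using hx'.2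
      rfl
    · intro u hu
      simp only [Finset.mem_erase, hC, Finset.mem_filter, mem_univ, true_and] at hu
      rcases hp : par u with _ | w
      · exact absurd (hF.root_unique hp hr hu.2) hu.1
      · exact ⟨⟨w, u⟩, by simp [hC, hp, hF.center_par hp, hu.2], rfl⟩
    · intros; rfl
  have h3 := Finset.add_sum_erase C s (a := r) (by simp [hC])
  omega

/-- The interval [a v, a v + s v) is reserved for the subtree of `v`. The intervals of children lie
in that of the parent, beyond its first element. -/
theorem child_interval (hs : ∀ v, s v = 1 + ∑ u with par u = some v, s u)
    (ha : ∀ v w, par v = some w →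
      a v = a w + 1 + ∑ u with par u = some w ∧ ident u < ident v, s u)
    {v w : V} (h : par v = some w) : a w < a v ∧ a v + s v ≤ a w + s w := by
  have h1 := ha v w h
  have h2 := hs w
  have h3 : ∑ u with par u = some w ∧ ident u < ident v, s u + s v ≤
      ∑ u with par u = some w, s u := by
    rw [add_comm, ← Finset.sum_insert (f := s) (by simp)]
    refine Finset.sum_le_sum_of_subset ?_
    intro u hu
    rcases Finset.mem_insert.1 hu with rfl | hu
    · simpa using h
    · simp only [Finset.mem_filter, mem_univ, true_and] at hu ⊢
      exact hu.1
  omega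

theorem sibling_interval
    (ha : ∀ v w, par v = some w →
      a v = a w + 1 + ∑ u with par u = some w ∧ ident u < ident v, s u)
    {v v' w : V} (h : par v = some w) (h' : par v' = some w) (hlt : ident v < ident v') :
    a v + s v ≤ a v' := by
  have h1 := ha v w h
  have h2 := ha v' w h'
  have h3 : ∑ u with par u = some w ∧ ident u < ident v, s u + s v ≤
      ∑ u with par u = some w ∧ ident u < ident v', s u := by
    rw [add_comm, ← Finset.sum_insert (f := s) (by simp)]
    refine Finset.sum_le_sum_of_subset ?_
    intro u hu
    rcases Finset.mem_insert.1 hu with rfl | hu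
    · simp [h, hlt]
    · simp only [Finset.mem_filter, mem_univ, true_and] at hu ⊢
      exact ⟨hu.1, hu.2.trans hlt⟩
  omega

/-- Both vertices climb in parallel until their parents coincide. There the intervals of siblings
are disjoint, and nesting passes this down. -/
theorem disjoint_of_level_eq (hF : IsForest center par level L) (hid : Function.Injective ident)
    (hs : ∀ v, s v = 1 + ∑ u with par u = some v, s u)
    (ha : ∀ v w, par v = some w →
      a v = a w + 1 + ∑ u with par u = some w ∧ ident u < ident v, s u)
    {u v : V} (hl : level u = level v) (hc : center u = center v) (hne : u ≠ v) :
    a u + s u ≤ a v ∨ a v + s v ≤ a u := by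
  induction h : level u using Nat.strong_induction_on generalizing u v with
  | _ l ih =>
    rcases hu : par u with _ | w
    · have := hF.level_root_lt hu hc hne; omega
    rcases hv : par v with _ | w'
    · have := hF.level_root_lt hv hc.symm hne.symm; omega
    by_cases hw : w = w'
    · subst hw
      rcases lt_or_gt_of_ne fun h => hne (hid h) with hlt | hlt
      · exact .inl (sibling_interval ha hu hv hlt)
      · exact .inr (sibling_interval ha hv hu hlt)
    · have h1 := hF.level_par hu
      have h2 := hF.level_par hv
      have h3 := child_interval hs ha hu
      have h4 := child_interval hs ha hv
      have := ih (level w) (by omega) (u := w) (v := w') (by omega)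
        (by rw [hF.center_par hu, hF.center_par hv, hc]) hw rfl
      omega

/-- The deeper vertex climbs until it reaches the level of the other or becomes its child. -/
theorem disjoint_or_nested (hF : IsForest center par level L) (hid : Function.Injective ident)
    (hs : ∀ v, s v = 1 + ∑ u with par u = some v, s u)
    (ha : ∀ v w, par v = some w →
      a v = a w + 1 + ∑ u with par u = some w ∧ ident u < ident v, s u)
    {u v : V} (hl : level u ≤ level v) (hc : center u = center v) (hne : u ≠ v) :
    a u + s u ≤ a v ∨ a v + s v ≤ a u ∨ (a u < a v ∧ a v + s v ≤ a u + s u) := by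
  induction h : level v using Nat.strong_induction_on generalizing v with
  | _ l ih =>
    rcases hl.eq_or_lt with hl | hl
    · rcases hF.disjoint_of_level_eq hid hs ha hl hc hne with h | h <;> simp [h]
    rcases hv : par v with _ | w
    · have := hF.level_root_lt hv hc.symm hne.symm; omega
    have h1 := hF.level_par hv
    have h2 := child_interval hs ha hv
    by_cases hw : u = w
    · subst hw; exact .inr (.inr h2)
    · have := ih (level w) (by omega) (v := w) (by omega) (by rw [hF.center_par hv, hc]) hw rfl
      omega

/-- Preorder numbers are distinct within a tree. -/
theorem label_ne (hF : IsForest center par level L) (hid : Function.Injective ident)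
    (hs : ∀ v, s v = 1 + ∑ u with par u = some v, s u)
    (ha : ∀ v w, par v = some w →
      a v = a w + 1 + ∑ u with par u = some w ∧ ident u < ident v, s u)
    {u v : V} (hc : center u = center v) (hne : u ≠ v) : a u ≠ a v := by
  have h1 := hs u
  have h2 := hs v
  rcases le_total (level u) (level v) with hl | hl
  · have := hF.disjoint_or_nested hid hs ha hl hc hne; omega
  · have := hF.disjoint_or_nested hid hs ha hl hc.symm hne.symm; omega

/-- The preorder numbers in a tree with `m` vertices are below `m`. -/
theorem label_add_size_le (hF : IsForest center par level L)
    (hs : ∀ v, s v = 1 + ∑ u with par u = some v, s u) (ha0 : ∀ v, par v = none → a v = 0)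
    (ha : ∀ v w, par v = some w →
      a v = a w + 1 + ∑ u with par u = some w ∧ ident u < ident v, s u) (v : V) :
    a v + s v ≤ (univ.filter fun u => center u = center v).card := by
  induction h : level v using Nat.strong_induction_on generalizing v with
  | _ l ih =>
    rcases hv : par v with _ | w
    · rw [ha0 v hv, hF.size_root hs hv, zero_add]
    · have h1 := hF.level_par hv
      have h2 := child_interval hs ha hv
      have := ih (level w) (by omega) w rfl
      rw [hF.center_par hv] at this
      omega

end IsForest

/-! ### Verdicts are final -/

namespace DistAlgorithm

variable {V : Type} [Fintype V] {G : SimpleGraph V} {ident : V → ℕ}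

theorem stateAt_of_le (A : DistAlgorithm) (ω : A.Coins V) {t t' : ℕ} {v : V} {b : Bool}
    (h : A.verdict G ident ω t v = some b) (htt : t ≤ t') :
    A.stateAt G ident ω t' v = A.stateAt G ident ω t v := by
  induction t', htt using Nat.le_induction with
  | base => rfl
  | succ m _ ih =>
    rw [verdict] at h
    rw [stateAt, ih, if_pos (by simp [h])]

theorem verdict_of_le (A : DistAlgorithm) (ω : A.Coins V) {t t' : ℕ} {v : V} {b : Bool}
    (h : A.verdict G ident ω t v = some b) (htt : t ≤ t') :
    A.verdict G ident ω t' v = some b := by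
  rw [verdict, A.stateAt_of_le ω h htt, ← h, verdict]

theorem outputs_iff (A : DistAlgorithm) (ω : A.Coins V) {t : ℕ} {v : V}
    (h : (A.verdict G ident ω t v).isSome) (b : Bool) :
    A.Outputs G ident ω v b ↔ A.verdict G ident ω t v = some b := by
  refine ⟨?_, fun h => ⟨t, h⟩⟩
  rintro ⟨t', ht'⟩
  obtain ⟨b', hb'⟩ := Option.isSome_iff_exists.1 h
  rcases le_total t t' with hle | hle
  · rw [← ht', hb', A.verdict_of_le ω hb' hle]
  · exact A.verdict_of_le ω ht' hle

end DistAlgorithm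

/-! ### Protocols of fixed duration -/

/-- A synchronous protocol that runs for a fixed number of rounds. Local computations may depend on
the round, and messages that are too long are suppressed. -/
structure Protocol where
  X : Type
  coins : ℕ → ℕ
  init : (n : ℕ) → ℕ → Finset ℕ → (Fin (coins n) → Bool) → X
  msg : ℕ → ℕ → X → ℕ → ℕ
  upd : ℕ → ℕ → X → (ℕ → ℕ) → X
  dur : ℕ → ℕ
  width : ℕ → ℕ
  acc : ℕ → X → Bool

/-- Suppress a message of more than `b` bits. -/
def clip (b m : ℕ) : ℕ := if m.size ≤ b then m else 0

theorem clip_of_size_le {b m : ℕ} (h : m.size ≤ b) : clip b m = m := if_pos h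

@[simp] theorem clip_zero (b : ℕ) : clip b 0 = 0 := by simp [clip]

theorem size_clip_le (b m : ℕ) : (clip b m).size ≤ b := by
  unfold clip
  split
  · assumption
  · simp

theorem size_le_mul_clog {n e b m : ℕ} (h : m < n ^ e) (he : e ≤ b) :
    m.size ≤ b * Nat.clog 2 n := by
  rw [Nat.size_le]
  calc m < n ^ e := h
    _ ≤ (2 ^ Nat.clog 2 n) ^ e := Nat.pow_le_pow_left (Nat.le_pow_clog one_lt_two n) e
    _ = 2 ^ (e * Nat.clog 2 n) := by rw [← pow_mul, mul_comm]
    _ ≤ 2 ^ (b * Nat.clog 2 n) := by gcongr; norm_num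

section Deliver

variable {V : Type} (G : SimpleGraph V) (ident : V → ℕ)

/-- The inbox of `v` when every neighbour `u` sends `m u`. -/
noncomputable def deliver (v : V) (m : V → ℕ) : ℕ → ℕ :=
  Function.extend (fun u : G.neighborSet v => ident u) (fun u => m u) (fun _ => 0)

variable {G ident}

theorem deliver_ident (hid : Function.Injective ident) {u v : V} (h : G.Adj v u) (m : V → ℕ) :
    deliver G ident v m (ident u) = m u :=
  Function.Injective.extend_apply (f := fun u : G.neighborSet v => ident u)
    (fun _ _ hab => Subtype.ext (hid hab)) _ _ (⟨u, h⟩ : G.neighborSet v)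

end Deliver

namespace Protocol

noncomputable section

variable (Q : Protocol)

/-- The protocol as a distributed algorithm. -/
def toAlgorithm : DistAlgorithm where
  State := ℕ × ℕ × Q.X
  coins := Q.coins
  init n i s ω := (n, 0, Q.init n i s ω)
  send s i := clip (Q.width s.1) (Q.msg s.1 s.2.1 s.2.2 i)
  step s inbox := (s.1, s.2.1 + 1, Q.upd s.1 s.2.1 s.2.2 inbox)
  output s := if Q.dur s.1 ≤ s.2.1 then some (Q.acc s.1 s.2.2) else none

variable {V : Type} [Fintype V] (G : SimpleGraph V) (ident : V → ℕ)

open Classical in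
/-- The local states after `t` rounds, ignoring termination. -/
def run (ω : V → Fin (Q.coins (Fintype.card V)) → Bool) : ℕ → V → Q.X
  | 0, v => Q.init (Fintype.card V) (ident v) ((G.neighborFinset v).image ident) (ω v)
  | t + 1, v => Q.upd (Fintype.card V) t (run ω t v) (deliver G ident v fun u =>
      clip (Q.width (Fintype.card V)) (Q.msg (Fintype.card V) t (run ω t u) (ident v)))

variable {G ident}

theorem stateAt_eq (ω : Q.toAlgorithm.Coins V) {t : ℕ} (ht : t ≤ Q.dur (Fintype.card V)) (v : V) :
    Q.toAlgorithm.stateAt G ident ω t v = (Fintype.card V, t, Q.run G ident ω t v) := by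
  induction t generalizing v with
  | zero => rfl
  | succ t ih =>
    have hout : ∀ u, Q.toAlgorithm.output (Q.toAlgorithm.stateAt G ident ω t u) = none := by
      intro u
      rw [ih (by omega) u]
      exact if_neg (by simpa using ht)
    rw [DistAlgorithm.stateAt, if_neg (by simp [hout]), ih (by omega) v]
    have hm : ∀ u, Q.toAlgorithm.message (Q.toAlgorithm.stateAt G ident ω t u) (ident v) =
        clip (Q.width (Fintype.card V))
          (Q.msg (Fintype.card V) t (Q.run G ident ω t u) (ident v)) := by
      intro u
      rw [DistAlgorithm.message, if_neg (by simp [hout]), ih (by omega) u]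
      rfl
    simp only [hm]
    rfl

theorem verdict_dur (ω : Q.toAlgorithm.Coins V) (v : V) :
    Q.toAlgorithm.verdict G ident ω (Q.dur (Fintype.card V)) v =
      some (Q.acc (Fintype.card V) (Q.run G ident ω (Q.dur (Fintype.card V)) v)) := by
  rw [DistAlgorithm.verdict, Q.stateAt_eq ω le_rfl]
  exact if_pos le_rfl

theorem haltsWithin_dur : Q.toAlgorithm.HaltsWithin (Q.dur (Fintype.card V)) G ident := by
  intro ω v
  rw [verdict_dur]
  rfl

theorem outputs_iff (ω : Q.toAlgorithm.Coins V) (v : V) (b : Bool) :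
    Q.toAlgorithm.Outputs G ident ω v b ↔
      Q.acc (Fintype.card V) (Q.run G ident ω (Q.dur (Fintype.card V)) v) = b := by
  rw [Q.toAlgorithm.outputs_iff ω (Q.haltsWithin_dur ω v), verdict_dur, Option.some_inj]

theorem respectsBandwidth (B : ℕ) (h : Q.width (Fintype.card V) = B * Nat.clog 2 (Fintype.card V)) :
    Q.toAlgorithm.RespectsBandwidth B G ident := by
  have hn : ∀ (ω : Q.toAlgorithm.Coins V) t v,
      (Q.toAlgorithm.stateAt G ident ω t v).1 = Fintype.card V := by
    intro ω t
    induction t with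
    | zero => intro v; rfl
    | succ t ih =>
      intro v
      rw [DistAlgorithm.stateAt]
      split
      · exact ih v
      · exact ih v
  intro ω t u v _
  rw [DistAlgorithm.message]
  split
  · simp
  · rw [← h, ← hn ω t u]
    exact size_clip_le _ _

end

end Protocol

/-! ### Flooding -/

/-- One round of flooding, from time `t` to `t + 1`. A clustered vertex keeps its data; an
unclustered one joins the cluster of a clustered neighbour, or opens a cluster of its own at its
start time. Centers are stored as `ident + 1`, with `0` for an unclustered vertex; likewise for
parents. -/
def FloodStep {V : Type} (G : SimpleGraph V) (ident start : V → ℕ) (c p l : ℕ → V → ℕ)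
    (t : ℕ) (v : V) : Prop :=
  (c t v ≠ 0 ∧ c (t + 1) v = c t v ∧ p (t + 1) v = p t v ∧ l (t + 1) v = l t v) ∨
  (c t v = 0 ∧ ∃ w, G.Adj v w ∧ c t w ≠ 0 ∧ c (t + 1) v = c t w ∧ p (t + 1) v = ident w + 1 ∧
    l (t + 1) v = t + 1) ∨
  (c t v = 0 ∧ (∀ w, G.Adj v w → c t w = 0) ∧ start v ≤ t ∧ c (t + 1) v = ident v + 1 ∧
    p (t + 1) v = 0 ∧ l (t + 1) v = t + 1) ∨
  (c t v = 0 ∧ (∀ w, G.Adj v w → c t w = 0) ∧ t < start v ∧ c (t + 1) v = 0)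

/-- The invariant of flooding. -/
structure FloodInv {V : Type} (G : SimpleGraph V) (ident start : V → ℕ) (c p l : V → ℕ)
    (t : ℕ) : Prop where
  level_le : ∀ v, c v ≠ 0 → l v ≤ t
  exists_walk : ∀ v, c v ≠ 0 → ∃ (u : V) (q : G.Walk u v),
    c v = ident u + 1 ∧ start u + 1 + q.length ≤ l v
  parent : ∀ v, c v ≠ 0 → (p v = 0 ∧ c v = ident v + 1) ∨
    ∃ w, G.Adj v w ∧ p v = ident w + 1 ∧ c w = c v ∧ l w + 1 = l v
  -- A clustered neighbour of an unclustered vertex must have joined in the very last round;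
  -- otherwise its cluster would have spread already.
  fresh : ∀ v, c v = 0 → t ≤ start v ∧ ∀ w, G.Adj v w → c w ≠ 0 → l w = t
  level_le_start : ∀ v, c v ≠ 0 → l v ≤ start v + 1
  level_le_adj : ∀ v w, G.Adj v w → c v ≠ 0 → c w ≠ 0 → l v ≤ l w + 1

section Flood

variable {V : Type} {G : SimpleGraph V} {ident start : V → ℕ} {c p l : ℕ → V → ℕ}

/-- Clustered vertices keep their data and new ones get level `t + 1`. By `fresh`, the parent of a
vertex that joins now has level exactly `t`, so levels grow by one along tree edges. -/
theorem FloodInv.step {t : ℕ} (hI : FloodInv G ident start (c t) (p t) (l t) t)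
    (hs : ∀ v, FloodStep G ident start c p l t v) :
    FloodInv G ident start (c (t + 1)) (p (t + 1)) (l (t + 1)) (t + 1) := by
  have hold : ∀ v, c t v ≠ 0 → c (t + 1) v = c t v ∧ p (t + 1) v = p t v ∧ l (t + 1) v = l t v := by
    intro v hv
    rcases hs v with h | h | h | h
    · exact h.2
    · exact absurd h.1 hv
    · exact absurd h.1 hv
    · exact absurd h.1 hv
  have hnew : ∀ v, c t v = 0 → c (t + 1) v ≠ 0 → l (t + 1) v = t + 1 := by
    intro v hv hv'
    rcases hs v with h | h | h | h
    · exact absurd hv h.1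
    · obtain ⟨-, w, h⟩ := h; exact h.2.2.2.2
    · exact h.2.2.2.2.2
    · exact absurd h.2.2.2 hv'
  refine ⟨fun v hv => ?_, fun v hv => ?_, fun v hv => ?_, fun v hv => ?_, fun v hv => ?_,
    fun v w hvw hv hw => ?_⟩
  · by_cases h : c t v = 0
    · exact (hnew v h hv).le
    · rw [(hold v h).2.2]
      exact (hI.level_le v h).trans (Nat.le_succ t)
  · rcases hs v with ⟨h, h1, -, h3⟩ | ⟨h, w, hw, h0, h1, h2, h3⟩ | ⟨h, -, h0, h1, h2, h3⟩ | h
    · rw [h1, h3]; exact hI.exists_walk v h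
    · obtain ⟨u, q, hu, hq⟩ := hI.exists_walk w h0
      refine ⟨u, q.concat hw.symm, h1.trans hu, ?_⟩
      have := hI.level_le w h0
      rw [SimpleGraph.Walk.length_concat, h3]; omega
    · exact ⟨v, .nil, h1, by simp [h3]; omega⟩
    · exact absurd h.2.2.2 hv
  · rcases hs v with ⟨h, h1, h2, h3⟩ | ⟨h, w, hw, h0, h1, h2, h3⟩ | ⟨h, -, h0, h1, h2, h3⟩ | h
    · rw [h1, h2, h3]
      rcases hI.parent v h with h' | ⟨w, hw, hp, hc, hl⟩
      · exact .inl h'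
      · obtain ⟨k1, k2, k3⟩ := hold w (by rw [hc]; exact h)
        exact .inr ⟨w, hw, hp, k1.trans hc, by rw [k3, hl]⟩
    · obtain ⟨k1, k2, k3⟩ := hold w h0
      exact .inr ⟨w, hw, h2, k1.trans h1.symm, by rw [k3, h3, (hI.fresh v h).2 w hw h0]⟩
    · exact .inl ⟨h2, h1⟩
    · exact absurd h.2.2.2 hv
  · rcases hs v with ⟨h, h1, -, -⟩ | ⟨h, w, hw, h0, h1, h2, h3⟩ | ⟨h, -, h0, h1, h2, h3⟩ |
      ⟨h, h0, h1, h2⟩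
    · exact absurd (h1.symm.trans hv) h
    · exact absurd (h1.symm.trans hv) h0
    · omega
    · exact ⟨h1, fun w hw hw' => hnew w (h0 w hw) hw'⟩
  · by_cases h : c t v = 0
    · have := (hI.fresh v h).1
      rw [hnew v h hv]; omega
    · rw [(hold v h).2.2]; exact hI.level_le_start v h
  · by_cases h : c t v = 0
    · rw [hnew v h hv]
      by_cases h' : c t w = 0
      · rw [hnew w h' hw]; omega
      · rw [(hold w h').2.2, (hI.fresh v h).2 w hvw h']
    · rw [(hold v h).2.2]
      by_cases hcw : c t w = 0
      · have := hI.level_le v h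
        rw [hnew w hcw hw]; omega
      · rw [(hold w hcw).2.2]
        exact hI.level_le_adj v w hvw h hcw

/-- Flooding works as long as the transmitted centers `ident v + 1` are not suppressed. -/
theorem floodInv {b T : ℕ} (hb : ∀ v, (ident v + 1).size ≤ b) (h0 : ∀ v, c 0 v = 0)
    (hs : ∀ t < T, (∀ v, (c t v).size ≤ b) → ∀ v, FloodStep G ident start c p l t v) :
    ∀ t ≤ T, FloodInv G ident start (c t) (p t) (l t) t := by
  intro t ht
  induction t with
  | zero => constructor <;> simp [h0]
  | succ t ih =>
    have hI := ih (by omega)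
    refine hI.step (hs t ht fun v => ?_)
    by_cases h : c t v = 0
    · simp [h]
    · obtain ⟨u, -, hu, -⟩ := hI.exists_walk v h
      rw [hu]; exact hb u

end Flood

/-- The outcome of flooding with start times below `L`. -/
structure IsClustering {V : Type} (G : SimpleGraph V) (ident start : V → ℕ) (c : V → ℕ)
    (par : V → Option V) (l : V → ℕ) (L : ℕ) : Prop where
  forest : IsForest c par l L
  adj_par : ∀ {v w}, par v = some w → G.Adj v w
  one_le_level : ∀ v, 1 ≤ l v
  exists_walk : ∀ v, ∃ (u : V) (q : G.Walk u v), c v = ident u + 1 ∧ start u + 1 + q.length ≤ l v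
  level_le_walk : ∀ {u v} (q : G.Walk u v), l v ≤ start u + 1 + q.length

/-- By `fresh`, a vertex unclustered at time `L` would start no earlier than `L`, so every vertex is
clustered. The upper bound on levels follows by induction along the walk, as adjacent levels differ
by at most 1. -/
theorem FloodInv.exists_isClustering {V : Type} {G : SimpleGraph V} {ident start c p l : V → ℕ}
    {L : ℕ} (hid : Function.Injective ident) (hI : FloodInv G ident start c p l L)
    (hst : ∀ v, start v < L) :
    ∃ par : V → Option V, IsClustering G ident start c par l L ∧
      (∀ v, par v = none → p v = 0) ∧ ∀ v w, par v = some w → p v = ident w + 1 := by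
  have hc : ∀ v, c v ≠ 0 := fun v h => by
    have := (hI.fresh v h).1
    have := hst v
    omega
  have hex : ∀ v, ∃ o : Option V, (o = none → p v = 0 ∧ c v = ident v + 1) ∧
      ∀ w, o = some w → G.Adj v w ∧ p v = ident w + 1 ∧ c w = c v ∧ l w + 1 = l v := by
    intro v
    rcases hI.parent v (hc v) with h | ⟨w, h⟩
    · exact ⟨none, fun _ => h, by simp⟩
    · exact ⟨some w, by simp, fun w' hw' => by simp only [Option.some.injEq] at hw'; subst hw'; exact h⟩
  choose par h0 h1 using hex
  refine ⟨par, ⟨⟨fun h => (h1 _ _ h).2.2.1, fun h => (h1 _ _ h).2.2.2, ?_,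
    fun v => hI.level_le v (hc v)⟩, fun h => (h1 _ _ h).1, ?_, fun v => hI.exists_walk v (hc v), ?_⟩,
    fun v h => (h0 v h).1, fun v w h => (h1 v w h).2.1⟩
  · intro v w hv hw h
    rw [(h0 v hv).2, (h0 w hw).2] at h
    exact hid (by omega)
  · intro v
    obtain ⟨u, q, -, h⟩ := hI.exists_walk v (hc v)
    omega
  · intro u v q
    induction q using SimpleGraph.Walk.concatRec with
    | Hnil => simpa using hI.level_le_start _ (hc _)
    | Hconcat q h ih =>
      rw [SimpleGraph.Walk.length_concat]
      have := hI.level_le_adj _ _ h.symm (hc _) (hc _)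
      omega

open Classical in
/-- The distance from `u` to `v`, or a large number if there is no path. -/
noncomputable def cappedDist {V : Type} (G : SimpleGraph V) (K : ℕ) (v u : V) : ℕ :=
  if G.Reachable u v then G.dist u v else K

/-- A vertex whose shifted distances have a gap lies in the same cluster as its neighbours. -/
theorem IsClustering.center_eq_of_hasGap {V : Type} {G : SimpleGraph V} {ident c l : V → ℕ}
    {par : V → Option V} {L K : ℕ} {y : V → ℕ} (hy : ∀ v, y v < K)
    (hC : IsClustering G ident (fun v => K - y v) c par l L) {v w : V} (hvw : G.Adj v w)
    (hg : HasGap (cappedDist G K v) y) : c v = c w := by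
  obtain ⟨u, hu⟩ := hg
  -- An unreachable leader would have to beat `v` itself, whose distance is 0, despite a penalty `K`
  -- that exceeds every shift.
  have hreach : G.Reachable u v := by
    by_contra hn
    have hvu : v ≠ u := by rintro rfl; exact hn (.refl _)
    have h := hu v hvu
    rw [cappedDist, if_neg hn, cappedDist, if_pos (.refl v), SimpleGraph.dist_self] at h
    have := hy u
    omega
  obtain ⟨q, hq⟩ := hreach.exists_walk_length_eq_dist
  have hDu : cappedDist G K v u = q.length := by rw [cappedDist, if_pos hreach, hq]
  have hD : ∀ {u'} (q' : G.Walk u' v), cappedDist G K v u' ≤ q'.length := fun q' => by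
    rw [cappedDist, if_pos q'.reachable]
    exact SimpleGraph.dist_le q'
  have hv : c v = ident u + 1 := by
    obtain ⟨u', q', h1, h2⟩ := hC.exists_walk v
    by_cases huu : u' = u
    · rw [h1, huu]
    · have h3 := hu u' huu
      have h4 := hD q'
      have h5 := hC.level_le_walk q
      have h6 := hy u
      have h7 := hy u'
      omega
  -- Passing from `v` to `w` changes the distance from the leader and that from a rival by at most 1
  -- each. A lead of 3 survives this loss of 2.
  have hw : c w = ident u + 1 := by
    obtain ⟨u', q', h1, h2⟩ := hC.exists_walk w
    by_cases huu : u' = u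
    · rw [h1, huu]
    · have h3 := hu u' huu
      have h4 := hD (q'.concat hvw.symm)
      have h5 := hC.level_le_walk (q.concat hvw)
      have h6 := hy u
      have h7 := hy u'
      rw [SimpleGraph.Walk.length_concat] at h4 h5
      omega
  rw [hv, hw]

/-! ### Clusters -/

section Cluster

variable {V : Type} {G : SimpleGraph V} {ident start c l : V → ℕ} {par : V → Option V} {L : ℕ}

theorem IsClustering.exists_walk_root (hC : IsClustering G ident start c par l L) {r : V}
    (hr : par r = none) (k : ℕ) (u : {u | c u = k}) (hru : r ∈ {u | c u = k}) :
    ∃ q : (G.induce {u | c u = k}).Walk ⟨r, hru⟩ u, q.length ≤ l u := by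
  obtain ⟨u, hu⟩ := u
  have hu' : c u = k := hu
  have hr' : c r = k := hru
  induction h : l u using Nat.strong_induction_on generalizing u with
  | _ j ih =>
    rcases hp : par u with _ | w
    · obtain rfl := hC.forest.root_unique hr hp (hr'.trans hu'.symm)
      exact ⟨.nil, by simp⟩
    · have hl := hC.forest.level_par hp
      have hw : c w = k := (hC.forest.center_par hp).trans hu'
      obtain ⟨q, hq⟩ := ih (l w) (by omega) w hw hw rfl
      have hadj : (G.induce {u | c u = k}).Adj ⟨w, hw⟩ ⟨u, hu⟩ := (hC.adj_par hp).symm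
      refine ⟨q.concat hadj, ?_⟩
      rw [SimpleGraph.Walk.length_concat]
      omega

/-- Tree paths to the root stay inside the cluster and have length at most `L`. Finiteness of the
extended diameter also yields connectedness. -/
theorem IsClustering.ediam_le (hC : IsClustering G ident start c par l L) (v : V) :
    (G.induce {u | c u = c v}).ediam ≤ (2 * L : ℕ) := by
  obtain ⟨r, h1, h2, -, -⟩ := hC.forest.exists_root v
  have hecc : (G.induce {u | c u = c v}).eccent ⟨r, h2⟩ ≤ L := by
    rw [SimpleGraph.eccent_le_iff]
    intro u
    obtain ⟨q, hq⟩ := hC.exists_walk_root h1 (c v) u h2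
    refine (SimpleGraph.edist_le q).trans ?_
    exact_mod_cast hq.trans (hC.forest.level_le u)
  refine (SimpleGraph.ediam_le_two_mul_eccent ⟨r, h2⟩).trans ?_
  push_cast
  gcongr

theorem IsClustering.connected (hC : IsClustering G ident start c par l L) (v : V) :
    (G.induce {u | c u = c v}).Connected := by
  have : Nonempty {u | c u = c v} := ⟨⟨v, rfl⟩⟩
  exact SimpleGraph.connected_of_ediam_ne_top
    (ne_top_of_le_ne_top (ENat.natCast_ne_top _) (hC.ediam_le v))

theorem IsClustering.diam_le (hC : IsClustering G ident start c par l L) (v : V) :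
    (G.induce {u | c u = c v}).diam ≤ 2 * L :=
  ENat.toNat_le_of_le_natCast (hC.ediam_le v)

end Cluster

/-! ### The testing protocol -/

/-- The parameters of the testing protocol: a verifier, the random start times of the clusters with
a bound `L`, the number `R` of rounds in which the verifier is simulated, the bandwidth, and an
immediate verdict for those `n` for which no communication is needed. -/
structure TesterData where
  ver : DistAlgorithm
  coins : ℕ → ℕ
  start : (n : ℕ) → (Fin (coins n) → Bool) → ℕ
  L : ℕ → ℕ
  R : ℕ → ℕ
  width : ℕ → ℕ
  skip : ℕ → Option Bool

/-- The memory of a processor: its own ID and those of its neighbours, the start time, the cluster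
center, the parent and the level in the cluster tree, the size of its subtree and the messages of
its children about theirs, its number in the cluster and the size of the cluster, the messages of
the neighbours about their clusters and numbers, and the state of the simulated verifier. -/
structure Node (σ : Type) where
  own : ℕ
  nbrs : Finset ℕ
  start : ℕ
  center : ℕ
  parent : ℕ
  level : ℕ
  size : ℕ
  kids : ℕ → ℕ
  label : ℕ
  total : ℕ
  info : ℕ → ℕ
  inner : σ

namespace TesterData

noncomputable section

open Classical in
/-- A round of flooding. -/
def flood {σ : Type} (t : ℕ) (x : Node σ) (inbox : ℕ → ℕ) : Node σ :=
  if x.center ≠ 0 then x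
  else if h : ∃ i ∈ x.nbrs, inbox i ≠ 0 then
    { x with center := inbox h.choose, parent := h.choose + 1, level := t + 1 }
  else if x.start ≤ t then { x with center := x.own + 1, parent := 0, level := t + 1 }
  else x

/-- A round in which the sizes of subtrees are reported to the parents. -/
def collect {σ : Type} (x : Node σ) (inbox : ℕ → ℕ) : Node σ :=
  { x with kids := inbox, size := 1 + ∑ i ∈ x.nbrs, inbox i }

/-- A round in which numbers are assigned to the children. -/
def assign {σ : Type} (x : Node σ) (inbox : ℕ → ℕ) : Node σ :=
  if x.parent = 0 then { x with label := 0, total := x.size }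
  else { x with label := (inbox (x.parent - 1)).unpair.1,
                total := (inbox (x.parent - 1)).unpair.2 }

/-- The round in which neighbours are told about cluster and number, and the verifier starts. -/
def launch (A : DistAlgorithm) (x : Node A.State) (inbox : ℕ → ℕ) : Node A.State :=
  { x with
    info := inbox
    inner := A.init x.total x.label ((x.nbrs.filter fun i => (inbox i).unpair.1 = x.center).image
      fun i => (inbox i).unpair.2) (fun _ => false) }

open Classical in
/-- The inbox of the simulated verifier. -/
def translate {σ : Type} (x : Node σ) (inbox : ℕ → ℕ) (j : ℕ) : ℕ :=
  if h : ∃ i ∈ x.nbrs, (x.info i).unpair = (x.center, j) then inbox h.choose else 0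

/-- A round of the simulated verifier. -/
def simulate (A : DistAlgorithm) (x : Node A.State) (inbox : ℕ → ℕ) : Node A.State :=
  { x with inner := if (A.output x.inner).isSome then x.inner
                    else A.step x.inner (translate x inbox) }

variable (d : TesterData)

/-- The local computation at the end of a round. -/
def update (n t : ℕ) (x : Node d.ver.State) (inbox : ℕ → ℕ) : Node d.ver.State :=
  if t < d.L n then flood t x inbox
  else if t < 2 * d.L n then collect x inbox
  else if t < 3 * d.L n then assign x inbox
  else if t < 3 * d.L n + 1 then launch d.ver x inbox
  else simulate d.ver x inbox

/-- The message to neighbour `i`. -/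
def message (n t : ℕ) (x : Node d.ver.State) (i : ℕ) : ℕ :=
  if t < d.L n then x.center
  else if t < 2 * d.L n then (if x.parent = i + 1 then x.size else 0)
  else if t < 3 * d.L n then
    Nat.pair (x.label + 1 + ∑ j ∈ x.nbrs with j < i, x.kids j) x.total
  else if t < 3 * d.L n + 1 then Nat.pair x.center x.label
  else if (x.info i).unpair.1 = x.center then d.ver.message x.inner (x.info i).unpair.2
  else 0

/-- Cluster the network, number the vertices of each cluster, and run the verifier in each
cluster. -/
def protocol : Protocol where
  X := Node d.ver.State
  coins := d.coins
  init n i s ω :=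
    { own := i, nbrs := s, start := d.start n ω, center := 0, parent := 0, level := 0, size := 0,
      kids := 0, label := 0, total := 0, info := 0,
      inner := d.ver.init n i s (fun _ => false) }
  msg := d.message
  upd := d.update
  dur n := if (d.skip n).isSome then 0 else 3 * d.L n + 1 + d.R n
  width := d.width
  acc n x := (d.skip n).getD (decide (d.ver.output x.inner = some true))

/-! ### Fields of the memory that later phases leave unchanged -/

section Constant

variable {d} {n t : ℕ} (x : Node d.ver.State) (inbox : ℕ → ℕ)

theorem update_own : (d.update n t x inbox).own = x.own := by
  simp only [update, flood, collect, assign, launch, simulate]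
  split_ifs <;> rfl

theorem update_nbrs : (d.update n t x inbox).nbrs = x.nbrs := by
  simp only [update, flood, collect, assign, launch, simulate]
  split_ifs <;> rfl

theorem update_start : (d.update n t x inbox).start = x.start := by
  simp only [update, flood, collect, assign, launch, simulate]
  split_ifs <;> rfl

theorem update_cluster (h : d.L n ≤ t) :
    (d.update n t x inbox).center = x.center ∧ (d.update n t x inbox).parent = x.parent := by
  simp only [update, collect, assign, launch, simulate, if_neg (not_lt.2 h)]
  split_ifs <;> exact ⟨rfl, rfl⟩

theorem update_size (h : 2 * d.L n ≤ t) :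
    (d.update n t x inbox).size = x.size ∧ (d.update n t x inbox).kids = x.kids := by
  simp only [update, assign, launch, simulate, if_neg (not_lt.2 h),
    if_neg (not_lt.2 ((Nat.le_mul_of_pos_left _ two_pos).trans h))]
  split_ifs <;> exact ⟨rfl, rfl⟩

theorem update_label (h : 3 * d.L n ≤ t) :
    (d.update n t x inbox).label = x.label ∧ (d.update n t x inbox).total = x.total := by
  simp only [update, launch, simulate, if_neg (not_lt.2 h), if_neg (show ¬ t < d.L n by omega),
    if_neg (show ¬ t < 2 * d.L n by omega)]
  split_ifs <;> exact ⟨rfl, rfl⟩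

theorem update_info (h : 3 * d.L n + 1 ≤ t) :
    (d.update n t x inbox).info = x.info := by
  simp only [update, simulate, if_neg (not_lt.2 h), if_neg (show ¬ t < d.L n by omega),
    if_neg (show ¬ t < 2 * d.L n by omega), if_neg (show ¬ t < 3 * d.L n by omega)]

end Constant

end

end TesterData

/-! ### Executions of the protocol on a network -/

namespace TesterData

noncomputable section

/-- The bandwidth `w` suffices for the messages of the protocol. -/
structure Fits {V : Type} [Fintype V] (ident : V → ℕ) (w : ℕ) : Prop where
  center : ∀ v, (ident v + 1).size ≤ w
  count : ∀ m ≤ Fintype.card V, m.size ≤ w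
  pair : ∀ a ≤ Fintype.card V, ∀ b ≤ Fintype.card V, (Nat.pair a b).size ≤ w
  center_pair : ∀ v, ∀ b ≤ Fintype.card V, (Nat.pair (ident v + 1) b).size ≤ w

variable (d : TesterData) {V : Type} [Fintype V] (G : SimpleGraph V) (ident : V → ℕ)
  (ω : V → Fin (d.coins (Fintype.card V)) → Bool)

/-- The memory of `v` after `t` rounds. -/
def nodeAt (t : ℕ) (v : V) : Node d.ver.State := d.protocol.run G ident ω t v

/-- What `v` receives in the round after time `t`. -/
def inboxAt (t : ℕ) (v : V) : ℕ → ℕ :=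
  deliver G ident v fun u => clip (d.width (Fintype.card V))
    (d.message (Fintype.card V) t (d.nodeAt G ident ω t u) (ident v))

variable {d G ident ω}

theorem nodeAt_succ (t : ℕ) (v : V) : d.nodeAt G ident ω (t + 1) v =
    d.update (Fintype.card V) t (d.nodeAt G ident ω t v) (d.inboxAt G ident ω t v) := rfl

theorem nodeAt_own (t : ℕ) (v : V) : (d.nodeAt G ident ω t v).own = ident v := by
  induction t with
  | zero => rfl
  | succ t ih => rw [nodeAt_succ, update_own, ih]

theorem nodeAt_start (t : ℕ) (v : V) :
    (d.nodeAt G ident ω t v).start = d.start (Fintype.card V) (ω v) := by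
  induction t with
  | zero => rfl
  | succ t ih => rw [nodeAt_succ, update_start, ih]

open Classical in
theorem nodeAt_nbrs (t : ℕ) (v : V) :
    (d.nodeAt G ident ω t v).nbrs = (G.neighborFinset v).image ident := by
  induction t with
  | zero => rfl
  | succ t ih => rw [nodeAt_succ, update_nbrs, ih]

theorem mem_nbrs {t : ℕ} {v : V} {i : ℕ} :
    i ∈ (d.nodeAt G ident ω t v).nbrs ↔ ∃ u, G.Adj v u ∧ ident u = i := by
  classical
  simp [nodeAt_nbrs]

open Classical in
theorem sum_nbrs (hid : Function.Injective ident) (t : ℕ) (v : V) (f : ℕ → ℕ) :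
    ∑ i ∈ (d.nodeAt G ident ω t v).nbrs, f i = ∑ u with G.Adj v u, f (ident u) := by
  rw [nodeAt_nbrs, Finset.sum_image fun _ _ _ _ h => hid h]
  refine Finset.sum_congr ?_ fun _ _ => rfl
  ext u; simp

theorem nodeAt_cluster {t : ℕ} (ht : d.L (Fintype.card V) ≤ t) (v : V) :
    (d.nodeAt G ident ω t v).center =
        (d.nodeAt G ident ω (d.L (Fintype.card V)) v).center ∧
      (d.nodeAt G ident ω t v).parent =
        (d.nodeAt G ident ω (d.L (Fintype.card V)) v).parent := by
  induction t, ht using Nat.le_induction with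
  | base => exact ⟨rfl, rfl⟩
  | succ t ht ih =>
    rw [nodeAt_succ, (update_cluster _ _ ht).1, (update_cluster _ _ ht).2]
    exact ih

theorem nodeAt_size {t : ℕ} (ht : 2 * d.L (Fintype.card V) ≤ t) (v : V) :
    (d.nodeAt G ident ω t v).size =
        (d.nodeAt G ident ω (2 * d.L (Fintype.card V)) v).size ∧
      (d.nodeAt G ident ω t v).kids =
        (d.nodeAt G ident ω (2 * d.L (Fintype.card V)) v).kids := by
  induction t, ht using Nat.le_induction with
  | base => exact ⟨rfl, rfl⟩
  | succ t ht ih =>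
    rw [nodeAt_succ, (update_size _ _ ht).1, (update_size _ _ ht).2]
    exact ih

theorem nodeAt_label {t : ℕ} (ht : 3 * d.L (Fintype.card V) ≤ t) (v : V) :
    (d.nodeAt G ident ω t v).label =
        (d.nodeAt G ident ω (3 * d.L (Fintype.card V)) v).label ∧
      (d.nodeAt G ident ω t v).total =
        (d.nodeAt G ident ω (3 * d.L (Fintype.card V)) v).total := by
  induction t, ht using Nat.le_induction with
  | base => exact ⟨rfl, rfl⟩
  | succ t ht ih =>
    rw [nodeAt_succ, (update_label _ _ ht).1, (update_label _ _ ht).2]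
    exact ih

theorem nodeAt_info {t : ℕ} (ht : 3 * d.L (Fintype.card V) + 1 ≤ t) (v : V) :
    (d.nodeAt G ident ω t v).info =
        (d.nodeAt G ident ω (3 * d.L (Fintype.card V) + 1) v).info := by
  induction t, ht using Nat.le_induction with
  | base => rfl
  | succ t ht ih =>
    rw [nodeAt_succ, update_info _ _ ht]
    exact ih

/-! #### Flooding -/

theorem floodStep_nodeAt (hid : Function.Injective ident) {t : ℕ}
    (ht : t < d.L (Fintype.card V))
    (hw : ∀ v, (d.nodeAt G ident ω t v).center.size ≤ d.width (Fintype.card V)) (v : V) :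
    FloodStep G ident (fun v => d.start (Fintype.card V) (ω v))
      (fun t v => (d.nodeAt G ident ω t v).center) (fun t v => (d.nodeAt G ident ω t v).parent)
      (fun t v => (d.nodeAt G ident ω t v).level) t v := by
  have hin : ∀ u, G.Adj v u →
      d.inboxAt G ident ω t v (ident u) = (d.nodeAt G ident ω t u).center := by
    intro u hu
    rw [inboxAt, deliver_ident hid hu, message, if_pos ht, clip_of_size_le (hw u)]
  have hnext : d.nodeAt G ident ω (t + 1) v =
      flood t (d.nodeAt G ident ω t v) (d.inboxAt G ident ω t v) := by
    rw [nodeAt_succ, update, if_pos ht]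
  simp only [FloodStep, hnext]
  by_cases hc : (d.nodeAt G ident ω t v).center = 0
  · by_cases h : ∃ i ∈ (d.nodeAt G ident ω t v).nbrs, d.inboxAt G ident ω t v i ≠ 0
    · refine .inr (.inl ⟨hc, ?_⟩)
      have hsp := h.choose_spec
      obtain ⟨w, hadj, hw'⟩ := mem_nbrs.1 hsp.1
      refine ⟨w, hadj, ?_⟩
      rw [flood, if_neg (not_not.2 hc), dif_pos h]
      rw [← hw', hin w hadj] at hsp
      refine ⟨hsp.2, ?_, ?_, rfl⟩
      · rw [← hw', hin w hadj]
      · rw [← hw']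
    · have h' : ∀ w, G.Adj v w → (d.nodeAt G ident ω t w).center = 0 := by
        intro w hadj
        by_contra hne
        exact h ⟨ident w, mem_nbrs.2 ⟨w, hadj, rfl⟩, by rwa [hin w hadj]⟩
      by_cases hs : d.start (Fintype.card V) (ω v) ≤ t
      · refine .inr (.inr (.inl ⟨hc, h', hs, ?_⟩))
        rw [flood, if_neg (not_not.2 hc), dif_neg h, nodeAt_start, if_pos hs, nodeAt_own]
        exact ⟨rfl, rfl, rfl⟩
      · refine .inr (.inr (.inr ⟨hc, h', by omega, ?_⟩))
        rw [flood, if_neg (not_not.2 hc), dif_neg h, nodeAt_start, if_neg hs, hc]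
  · refine .inl ⟨hc, ?_⟩
    rw [flood, if_pos hc]
    exact ⟨rfl, rfl, rfl⟩

/-- The clusters computed by the protocol. -/
theorem exists_isClustering (hid : Function.Injective ident)
    (hf : Fits ident (d.width (Fintype.card V)))
    (hst : ∀ v, d.start (Fintype.card V) (ω v) < d.L (Fintype.card V)) :
    ∃ (par : V → Option V) (l : V → ℕ), IsClustering G ident
        (fun v => d.start (Fintype.card V) (ω v))
        (fun v => (d.nodeAt G ident ω (d.L (Fintype.card V)) v).center) par l
        (d.L (Fintype.card V)) ∧
      (∀ v, par v = none → (d.nodeAt G ident ω (d.L (Fintype.card V)) v).parent = 0) ∧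
      ∀ v w, par v = some w →
        (d.nodeAt G ident ω (d.L (Fintype.card V)) v).parent = ident w + 1 := by
  have hI := floodInv (G := G) (ident := ident) (start := fun v => d.start (Fintype.card V) (ω v))
    (c := fun t v => (d.nodeAt G ident ω t v).center)
    (p := fun t v => (d.nodeAt G ident ω t v).parent)
    (l := fun t v => (d.nodeAt G ident ω t v).level) (T := d.L (Fintype.card V))
    hf.center (fun v => rfl) (fun t ht hw => floodStep_nodeAt hid ht hw) _ le_rfl
  obtain ⟨par, h⟩ := hI.exists_isClustering hid hst
  exact ⟨par, _, h⟩

end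

end TesterData

/-! ### Cluster trees, numbering and simulation in an execution -/

namespace TesterData

noncomputable section

open Classical in
/-- The clusters and cluster trees computed by the protocol, with subtree sizes `s` and preorder
numbers `a`. -/
structure Clustered (d : TesterData) {V : Type} [Fintype V] (G : SimpleGraph V) (ident : V → ℕ)
    (ω : V → Fin (d.coins (Fintype.card V)) → Bool) (c : V → ℕ) (par : V → Option V)
    (l s a : V → ℕ) : Prop where
  inj : Function.Injective ident
  fits : Fits ident (d.width (Fintype.card V))
  center : ∀ v, (d.nodeAt G ident ω (d.L (Fintype.card V)) v).center = c v
  clustering : IsClustering G ident (fun v => d.start (Fintype.card V) (ω v)) c par l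
    (d.L (Fintype.card V))
  parent_none : ∀ v, par v = none →
    (d.nodeAt G ident ω (d.L (Fintype.card V)) v).parent = 0
  parent_some : ∀ v w, par v = some w →
    (d.nodeAt G ident ω (d.L (Fintype.card V)) v).parent = ident w + 1
  size_eq : ∀ v, s v = 1 + ∑ u with par u = some v, s u
  label_none : ∀ v, par v = none → a v = 0
  label_some : ∀ v w, par v = some w →
    a v = a w + 1 + ∑ u with par u = some w ∧ ident u < ident v, s u

theorem exists_clustered {d : TesterData} {V : Type} [Fintype V] {G : SimpleGraph V}
    {ident : V → ℕ} {ω : V → Fin (d.coins (Fintype.card V)) → Bool}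
    (hid : Function.Injective ident) (hf : Fits ident (d.width (Fintype.card V)))
    (hst : ∀ v, d.start (Fintype.card V) (ω v) < d.L (Fintype.card V)) :
    ∃ c par l s a, Clustered d G ident ω c par l s a := by
  classical
  obtain ⟨par, l, hC, h0, h1⟩ := exists_isClustering (G := G) hid hf hst
  obtain ⟨s, hs⟩ := hC.forest.exists_size
  obtain ⟨a, ha0, ha⟩ := hC.forest.exists_label ident s
  exact ⟨_, par, l, s, a, hid, hf, fun _ => rfl, hC, h0, h1, by convert hs, ha0, by convert ha⟩

namespace Clustered

variable {d : TesterData} {V : Type} [Fintype V] {G : SimpleGraph V} {ident : V → ℕ}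
  {ω : V → Fin (d.coins (Fintype.card V)) → Bool} {c l s a : V → ℕ} {par : V → Option V}

theorem center_eq (S : Clustered d G ident ω c par l s a) {t : ℕ}
    (ht : d.L (Fintype.card V) ≤ t) (v : V) : (d.nodeAt G ident ω t v).center = c v := by
  rw [(nodeAt_cluster ht v).1, S.center]

theorem parent_eq_iff (S : Clustered d G ident ω c par l s a) {t : ℕ}
    (ht : d.L (Fintype.card V) ≤ t) (u v : V) :
    (d.nodeAt G ident ω t u).parent = ident v + 1 ↔ par u = some v := by
  rw [(nodeAt_cluster ht u).2]
  rcases h : par u with _ | w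
  · simp [S.parent_none u h]
  · simp only [S.parent_some u w h, Nat.add_right_cancel_iff, Option.some.injEq]
    exact S.inj.eq_iff

theorem label_add_size_le (S : Clustered d G ident ω c par l s a) [DecidableEq V] (v : V) :
    a v + s v ≤ Fintype.card {u | c u = c v} := by
  have h := S.clustering.forest.label_add_size_le (ident := ident) (s := s) (a := a)
    (by convert S.size_eq) S.label_none (by convert S.label_some) v
  rw [Fintype.card_subtype]
  exact h

theorem size_pos (S : Clustered d G ident ω c par l s a) (v : V) : 0 < s v := by
  have := S.size_eq v
  omega

theorem label_lt (S : Clustered d G ident ω c par l s a) [DecidableEq V] (v : V) :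
    a v < Fintype.card {u | c u = c v} := by
  have := S.label_add_size_le v
  have := S.size_pos v
  omega

theorem size_le (S : Clustered d G ident ω c par l s a) [DecidableEq V] (v : V) :
    s v ≤ Fintype.card V := by
  have := S.label_add_size_le v
  have : Fintype.card {u | c u = c v} ≤ Fintype.card V := Fintype.card_subtype_le _
  omega

theorem label_le (S : Clustered d G ident ω c par l s a) [DecidableEq V] (v : V) :
    a v ≤ Fintype.card V := by
  have := S.label_lt v
  have : Fintype.card {u | c u = c v} ≤ Fintype.card V := Fintype.card_subtype_le _
  omega

theorem label_injOn (S : Clustered d G ident ω c par l s a) {u v : V} (hc : c u = c v)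
    (h : a u = a v) : u = v := by
  classical
  by_contra hne
  exact S.clustering.forest.label_ne S.inj (by convert S.size_eq) (by convert S.label_some) hc hne h

/-! #### Subtree sizes -/

theorem inbox_collect (S : Clustered d G ident ω c par l s a) [DecidableEq V] {t : ℕ}
    (h1 : d.L (Fintype.card V) ≤ t) (h2 : t < 2 * d.L (Fintype.card V)) {u v : V}
    (h : G.Adj v u) : d.inboxAt G ident ω t v (ident u) =
      if par u = some v then clip (d.width (Fintype.card V)) (d.nodeAt G ident ω t u).size
      else 0 := by
  rw [inboxAt, deliver_ident S.inj h, message, if_neg (by omega), if_pos h2]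
  simp only [S.parent_eq_iff h1]
  split_ifs <;> simp

theorem nodeAt_collect {t : ℕ} (h1 : d.L (Fintype.card V) ≤ t)
    (h2 : t < 2 * d.L (Fintype.card V)) (v : V) : d.nodeAt G ident ω (t + 1) v =
      collect (d.nodeAt G ident ω t v) (d.inboxAt G ident ω t v) := by
  rw [nodeAt_succ, update, if_neg (by omega), if_pos h2]

/-- Sizes become correct from the deepest level upwards: after `k` rounds at all levels above `L -
k`, because the children, one level deeper, were correct a round earlier. -/
theorem nodeAt_size_eq (S : Clustered d G ident ω c par l s a) {k : ℕ}
    (hk : k ≤ d.L (Fintype.card V)) (v : V) (hv : d.L (Fintype.card V) + 1 ≤ k + l v) :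
    (d.nodeAt G ident ω (d.L (Fintype.card V) + k) v).size = s v := by
  classical
  induction k generalizing v with
  | zero => have := S.clustering.forest.level_le v; omega
  | succ k ih =>
    rw [← add_assoc, nodeAt_collect (by omega) (by omega)]
    simp only [collect]
    rw [sum_nbrs S.inj, S.size_eq v]
    congr 1
    rw [Finset.sum_congr rfl fun u hu => S.inbox_collect (by omega) (by omega)
      (Finset.mem_filter.1 hu).2, ← Finset.sum_filter, Finset.filter_filter]
    refine Finset.sum_congr ?_ fun u hu => ?_
    · ext u
      simp only [Finset.mem_filter, mem_univ, true_and, and_iff_right_iff_imp]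
      exact fun h => (S.clustering.adj_par h).symm
    · have hp := (Finset.mem_filter.1 hu).2
      have := S.clustering.forest.level_par hp
      rw [ih (by omega) u (by omega), clip_of_size_le (S.fits.count _ (S.size_le u))]

/-- The stored reports come from the last collecting round and were sent one round before the end.
Children have level at least 2, so their sizes were correct by then. -/
theorem nodeAt_kids_eq (S : Clustered d G ident ω c par l s a) [DecidableEq V] {t : ℕ}
    (ht : 2 * d.L (Fintype.card V) ≤ t) {u v : V} (h : G.Adj v u) :
    (d.nodeAt G ident ω t v).kids (ident u) = if par u = some v then s u else 0 := by
  have h1 := S.clustering.one_le_level v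
  have h2 := S.clustering.forest.level_le v
  rw [(nodeAt_size ht v).2]
  obtain ⟨k, hk⟩ : ∃ k, d.L (Fintype.card V) = k + 1 := ⟨d.L (Fintype.card V) - 1, by omega⟩
  rw [show 2 * d.L (Fintype.card V) = d.L (Fintype.card V) + k + 1 by omega,
    nodeAt_collect (by omega) (by omega)]
  simp only [collect]
  rw [S.inbox_collect (by omega) (by omega) h]
  split_ifs with hp
  · have := S.clustering.forest.level_par hp
    rw [S.nodeAt_size_eq (by omega) u (by omega), clip_of_size_le (S.fits.count _ (S.size_le u))]
  · rfl

/-! #### Preorder numbers -/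

theorem message_assign (S : Clustered d G ident ω c par l s a) {t : ℕ}
    (h1 : 2 * d.L (Fintype.card V) ≤ t) (h2 : t < 3 * d.L (Fintype.card V)) {v w : V}
    (h : par v = some w) (hl : (d.nodeAt G ident ω t w).label = a w) :
    d.message (Fintype.card V) t (d.nodeAt G ident ω t w) (ident v) =
      Nat.pair (a v) (d.nodeAt G ident ω t w).total := by
  classical
  rw [message, if_neg (by omega), if_neg (by omega), if_pos h2, hl, S.label_some v w h]
  congr 2
  rw [Finset.sum_filter, sum_nbrs S.inj, ← Finset.sum_filter, Finset.filter_filter,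
    Finset.sum_congr rfl fun u hu => S.nodeAt_kids_eq h1 (Finset.mem_filter.1 hu).2.1,
    ← Finset.sum_filter, Finset.filter_filter]
  refine Finset.sum_congr ?_ fun _ _ => rfl
  ext u
  simp only [Finset.mem_filter, mem_univ, true_and]
  constructor
  · rintro ⟨⟨-, h3⟩, h4⟩
    exact ⟨h4, h3⟩
  · rintro ⟨h3, h4⟩
    exact ⟨⟨(S.clustering.adj_par h3).symm, h4⟩, h3⟩

/-- Numbers spread from the roots downwards, one level per round. The root knows the cluster size as
its own subtree size, and passes it on together with the numbers. -/
theorem nodeAt_label_eq_aux (S : Clustered d G ident ω c par l s a) [DecidableEq V] {k : ℕ}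
    (hk : k ≤ d.L (Fintype.card V)) (v : V) (hv : l v ≤ k) :
    (d.nodeAt G ident ω (2 * d.L (Fintype.card V) + k) v).label = a v ∧
      (d.nodeAt G ident ω (2 * d.L (Fintype.card V) + k) v).total =
        Fintype.card {u | c u = c v} := by
  have hone := S.clustering.one_le_level
  induction k generalizing v with
  | zero => have := hone v; omega
  | succ k ih =>
    rw [← add_assoc, nodeAt_succ, update, if_neg (by omega), if_neg (by omega), if_pos (by omega)]
    rcases hp : par v with _ | w
    · have hz : (d.nodeAt G ident ω (2 * d.L (Fintype.card V) + k) v).parent = 0 := by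
        rw [(nodeAt_cluster (by omega) v).2, S.parent_none v hp]
      rw [assign, if_pos hz]
      refine ⟨(S.label_none v hp).symm, ?_⟩
      simp only
      rw [(nodeAt_size (by omega) v).1, two_mul, S.nodeAt_size_eq le_rfl v (by have := hone v; omega),
        S.clustering.forest.size_root (s := s) (by convert S.size_eq) hp, Fintype.card_subtype]
      rfl
    · have hz : (d.nodeAt G ident ω (2 * d.L (Fintype.card V) + k) v).parent = ident w + 1 :=
        (S.parent_eq_iff (by omega) v w).2 hp
      have hl := S.clustering.forest.level_par hp
      obtain ⟨ih1, ih2⟩ := ih (by omega) w (by omega)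
      rw [S.clustering.forest.center_par hp] at ih2
      have hin : d.inboxAt G ident ω (2 * d.L (Fintype.card V) + k) v (ident w) =
          Nat.pair (a v) (Fintype.card {u | c u = c v}) := by
        rw [inboxAt, deliver_ident S.inj (S.clustering.adj_par hp),
          S.message_assign (by omega) (by omega) hp ih1, ih2, clip_of_size_le]
        exact S.fits.pair _ (S.label_le v) _ (Fintype.card_subtype_le _)
      rw [assign, if_neg (by omega), hz, Nat.add_sub_cancel, hin, Nat.unpair_pair]
      exact ⟨rfl, rfl⟩

theorem nodeAt_label_eq (S : Clustered d G ident ω c par l s a) [DecidableEq V] {t : ℕ}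
    (ht : 3 * d.L (Fintype.card V) ≤ t) (v : V) :
    (d.nodeAt G ident ω t v).label = a v ∧
      (d.nodeAt G ident ω t v).total = Fintype.card {u | c u = c v} := by
  rw [(nodeAt_label ht v).1, (nodeAt_label ht v).2,
    show 3 * d.L (Fintype.card V) = 2 * d.L (Fintype.card V) + d.L (Fintype.card V) by ring]
  exact S.nodeAt_label_eq_aux le_rfl v (S.clustering.forest.level_le v)

/-! #### Simulation of the verifier -/

theorem inbox_launch (S : Clustered d G ident ω c par l s a) {u v : V} (h : G.Adj v u) :
    d.inboxAt G ident ω (3 * d.L (Fintype.card V)) v (ident u) = Nat.pair (c u) (a u) := by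
  classical
  rw [inboxAt, deliver_ident S.inj h, message, if_neg (by omega), if_neg (by omega),
    if_neg (by omega), if_pos (by omega), S.center_eq (by omega), (S.nodeAt_label_eq le_rfl u).1,
    clip_of_size_le]
  obtain ⟨w, -, hw, -⟩ := S.clustering.exists_walk u
  rw [hw]
  exact S.fits.center_pair w _ (S.label_le u)

theorem nodeAt_launch (v : V) : d.nodeAt G ident ω (3 * d.L (Fintype.card V) + 1) v =
    launch d.ver (d.nodeAt G ident ω (3 * d.L (Fintype.card V)) v)
      (d.inboxAt G ident ω (3 * d.L (Fintype.card V)) v) := by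
  rw [nodeAt_succ, update, if_neg (by omega), if_neg (by omega), if_neg (by omega),
    if_pos (by omega)]

theorem nodeAt_info_eq (S : Clustered d G ident ω c par l s a) {t : ℕ}
    (ht : 3 * d.L (Fintype.card V) + 1 ≤ t) {u v : V} (h : G.Adj v u) :
    (d.nodeAt G ident ω t v).info (ident u) = Nat.pair (c u) (a u) := by
  rw [nodeAt_info ht v, nodeAt_launch, ← S.inbox_launch h]
  rfl

/-- Within each cluster, the protocol runs the verifier. -/
theorem nodeAt_inner_eq (S : Clustered d G ident ω c par l s a) (k : ℕ)
    [Fintype {u | c u = k}] {B : ℕ}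
    (hB : d.ver.RespectsBandwidth B (G.induce {u | c u = k}) (fun u => a u))
    (hw : B * Nat.clog 2 (Fintype.card {u | c u = k}) ≤ d.width (Fintype.card V))
    (t : ℕ) (v : {u | c u = k}) :
    (d.nodeAt G ident ω (3 * d.L (Fintype.card V) + 1 + t) v).inner =
      d.ver.stateAt (G.induce {u | c u = k}) (fun u => a u) (fun _ _ => false) t v := by
  classical
  induction t generalizing v with
  | zero =>
    obtain ⟨v, rfl⟩ := v
    rw [add_zero, nodeAt_launch, DistAlgorithm.stateAt]
    have htot : (d.nodeAt G ident ω (3 * d.L (Fintype.card V)) v).total =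
        Fintype.card {u | c u = c v} :=
      (S.nodeAt_label_eq le_rfl v).2.trans
        (@Fintype.card_congr _ _ (_) (_) (Equiv.refl _))
    simp only [launch]
    rw [(S.nodeAt_label_eq le_rfl v).1, htot, S.center_eq (by omega)]
    congr 1
    ext j
    simp only [Finset.mem_image, Finset.mem_filter, mem_nbrs, SimpleGraph.mem_neighborFinset]
    constructor
    · rintro ⟨_, ⟨⟨u, hu, rfl⟩, hc⟩, hj⟩
      rw [S.inbox_launch hu, Nat.unpair_pair] at hc hj
      exact ⟨⟨u, hc⟩, hu, hj⟩
    · rintro ⟨⟨u, hc⟩, hu, hj⟩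
      have hu : G.Adj v u := hu
      exact ⟨ident u, ⟨⟨u, hu, rfl⟩, by rw [S.inbox_launch hu, Nat.unpair_pair]; exact hc⟩,
        by rw [S.inbox_launch hu, Nat.unpair_pair]; exact hj⟩
  | succ t ih =>
    have hstep : d.nodeAt G ident ω (3 * d.L (Fintype.card V) + 1 + (t + 1)) v =
        simulate d.ver (d.nodeAt G ident ω (3 * d.L (Fintype.card V) + 1 + t) v)
          (d.inboxAt G ident ω (3 * d.L (Fintype.card V) + 1 + t) v) := by
      rw [← add_assoc, nodeAt_succ, update, if_neg (by omega), if_neg (by omega),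
        if_neg (by omega), if_neg (by omega)]
    rw [hstep, DistAlgorithm.stateAt, simulate]
    simp only
    rw [ih v]
    split_ifs
    · rfl
    congr 1
    funext j
    have hv : c v = k := v.2
    have hin : ∀ u : {u | c u = k}, G.Adj v u →
        d.inboxAt G ident ω (3 * d.L (Fintype.card V) + 1 + t) v (ident u) =
          d.ver.message (d.ver.stateAt (G.induce {u | c u = k}) (fun u => a u)
            (fun _ _ => false) t u) (a v) := by
      intro u hu
      have hu' : c u = k := u.2
      rw [inboxAt, deliver_ident S.inj hu, message, if_neg (by omega), if_neg (by omega),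
        if_neg (by omega), if_neg (by omega), S.nodeAt_info_eq (by omega) hu.symm,
        Nat.unpair_pair, S.center_eq (by omega), if_pos (hv.trans hu'.symm), ih u, clip_of_size_le]
      exact (hB (fun _ _ => false) t u v hu.symm).trans hw
    by_cases h : ∃ u : (G.induce {u | c u = k}).neighborSet v, a u = j
    · obtain ⟨u, rfl⟩ := h
      have hu : G.Adj v u := u.2
      have huc : c u = k := u.1.2
      have hinj : Function.Injective
          (fun u : (G.induce {u | c u = k}).neighborSet v => a u) := fun u u' h =>
        Subtype.ext (Subtype.ext (S.label_injOn (u.1.2.trans u'.1.2.symm) h))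
      rw [hinj.extend_apply (f := fun u : (G.induce {u | c u = k}).neighborSet v => a u), ← hin u hu]
      have hex : ∃ i ∈ (d.nodeAt G ident ω (3 * d.L (Fintype.card V) + 1 + t) v).nbrs,
          ((d.nodeAt G ident ω (3 * d.L (Fintype.card V) + 1 + t) v).info i).unpair =
            ((d.nodeAt G ident ω (3 * d.L (Fintype.card V) + 1 + t) v).center, a u) :=
        ⟨ident u, mem_nbrs.2 ⟨u, hu, rfl⟩, by
          rw [S.nodeAt_info_eq (by omega) hu, Nat.unpair_pair, S.center_eq (by omega), huc, hv]⟩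
      rw [translate, dif_pos hex]
      congr 1
      -- The neighbour selected by choice is the intended one, because numbers are distinct within a
      -- cluster.
      obtain ⟨h1, h2⟩ := hex.choose_spec
      obtain ⟨u', hu', he⟩ := mem_nbrs.1 h1
      rw [← he] at h2 ⊢
      rw [S.nodeAt_info_eq (by omega) hu', Nat.unpair_pair, S.center_eq (by omega), hv,
        Prod.mk.injEq] at h2
      rw [S.label_injOn (h2.1.trans huc.symm) h2.2]
    · rw [Function.extend_apply' _ _ _ h, translate, dif_neg]
      rintro ⟨i, hi, he⟩
      obtain ⟨u, hu, rfl⟩ := mem_nbrs.1 hi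
      rw [S.nodeAt_info_eq (by omega) hu, Nat.unpair_pair, S.center_eq (by omega), hv,
        Prod.mk.injEq] at he
      exact h ⟨⟨⟨u, he.1⟩, hu⟩, he.2⟩

end Clustered

end

end TesterData

/-! ### Graph properties and clusters -/

/-- Only the edges within the classes of `c` are kept. -/
def withinClusters {V : Type} (G : SimpleGraph V) (c : V → ℕ) : SimpleGraph V where
  Adj u v := G.Adj u v ∧ c u = c v
  symm := ⟨fun _ _ h => ⟨h.1.symm, h.2.symm⟩⟩
  loopless := ⟨fun _ h => G.loopless.irrefl _ h.1⟩

namespace GraphProperty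

variable {P : GraphProperty} {V : Type} [Finite V] {G : SimpleGraph V}

/-- A witness inside an induced subgraph is also induced in `G`, so `P` is hereditary. -/
theorem NonDisjointed.holds_induce (hnd : P.NonDisjointed) (h : P.Holds G) (U : Set V)
    (hU : U.Nonempty) : P.Holds (G.induce U) := by
  by_contra hn
  have : Nonempty U := hU.to_subtype
  obtain ⟨U', -, hw⟩ := hnd.exists_witness U (G.induce U) hn
  exact hw V G ⟨(SimpleGraph.Embedding.induce U).comp (SimpleGraph.Embedding.induce U')⟩ h

/-- A connected witness cannot leave its class, and inside a class `G` and `withinClusters G c`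
agree. So the witness is an induced subgraph of that cluster of `G`. -/
theorem NonDisjointed.exists_cluster [Nonempty V] (hnd : P.NonDisjointed) (c : V → ℕ)
    (h : ¬ P.Holds (withinClusters G c)) : ∃ v, ¬ P.Holds (G.induce {u | c u = c v}) := by
  obtain ⟨U, hU, hw⟩ := hnd.exists_witness V _ h
  obtain ⟨U', -, hconn, hw'⟩ := hnd.connected_witness V _ U hU hw
  obtain ⟨v⟩ := hconn.nonempty
  have hc : ∀ u : U', c u = c v := by
    intro u
    obtain ⟨q⟩ := hconn.preconnected u v
    induction q with
    | nil => rfl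
    | cons h _ ih => exact h.2.trans ih
  refine ⟨v, hw' _ _ ⟨⟨⟨fun u => ⟨u, hc u⟩, fun u u' h => ?_⟩, ?_⟩⟩⟩
  · exact Subtype.ext (congrArg (fun x : {u | c u = c v} => (x : V)) h)
  · intro u u'
    change G.Adj u u' ↔ G.Adj u u' ∧ c u = c u'
    simp [hc]

/-- Few edges between clusters cannot account for the distance of `G` from `P`. -/
theorem IsFar.not_holds_withinClusters {ε : ℝ} (hfar : P.IsFar ε G) (c : V → ℕ)
    (F : Set (Sym2 V)) (hF : ∀ u v, G.Adj u v → c u ≠ c v → s(u, v) ∈ F)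
    (hlt : (F.ncard : ℝ) < ε * G.edgeSet.ncard) : ¬ P.Holds (withinClusters G c) := by
  intro h
  refine absurd ((hfar.2 _ h).trans ?_) (not_le.2 hlt)
  have : symmDiff G.edgeSet (withinClusters G c).edgeSet ⊆ F := by
    intro e
    induction e using Sym2.ind with
    | _ u v =>
      rw [Set.mem_symmDiff, SimpleGraph.mem_edgeSet, SimpleGraph.mem_edgeSet]
      rintro (⟨h1, h2⟩ | ⟨h1, h2⟩)
      · exact hF u v h1 fun hc => h2 ⟨h1, hc⟩
      · exact absurd h1.1 h2
  exact_mod_cast Set.ncard_le_ncard this (Set.toFinite F)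

theorem holds_bot_iff {V : Type} [Fintype V] :
    P.Holds (⊥ : SimpleGraph (Fin (Fintype.card V))) ↔ P.Holds (⊥ : SimpleGraph V) := by
  have e := Fintype.equivFin V
  have f : (⊥ : SimpleGraph V) ≃g (⊥ : SimpleGraph (Fin (Fintype.card V))) := ⟨e, by simp⟩
  exact ⟨P.iso_invariant ⟨f.symm⟩, P.iso_invariant ⟨f⟩⟩

/-- For 1 < ε, deleting all edges costs |E| < ε|E|; on at most one vertex `G` is edgeless anyway. In
these cases the tester can decide without communication by looking at the edgeless graph. -/
theorem IsFar.not_holds_bot {V : Type} [Fintype V] {G : SimpleGraph V} {ε : ℝ}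
    (h : P.IsFar ε G) (hs : Fintype.card V ≤ 1 ∨ 1 < ε) : ¬ P.Holds (⊥ : SimpleGraph V) := by
  intro hb
  have hne : G ≠ ⊥ := fun he => h.1 (he ▸ hb)
  have h2 := h.2 _ hb
  have hE : G.edgeSet.Nonempty := SimpleGraph.edgeSet_nonempty.2 hne
  have hpos : (0 : ℝ) < G.edgeSet.ncard := by
    exact_mod_cast (Set.ncard_pos (Set.toFinite _)).2 hE
  rcases hs with hs | hs
  · have := Fintype.card_le_one_iff_subsingleton.1 hs
    exact hne (Subsingleton.elim _ _)
  · simp only [SimpleGraph.edgeSet_bot, ← Set.bot_eq_empty, symmDiff_bot] at h2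
    nlinarith

end GraphProperty

/-! ### Correctness of the protocol -/

open Classical in
theorem DistAlgorithm.le_rejectProb (A : DistAlgorithm) {V : Type} [Fintype V]
    (G : SimpleGraph V) (ident : V → ℕ) (x : ℝ) (S : Finset (A.Coins V))
    (hS : x * (Fintype.card (A.Coins V) : ℝ) ≤ S.card)
    (h : ∀ ω ∈ S, ∃ v, A.Outputs G ident ω v false) : x ≤ A.rejectProb G ident := by
  have hpos : (0 : ℝ) < Fintype.card (A.Coins V) := by exact_mod_cast Fintype.card_pos
  rw [rejectProb, le_div_iff₀ hpos]
  refine hS.trans ?_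
  rw [Fintype.card_subtype]
  exact_mod_cast Finset.card_le_card fun ω hω => by simpa using h ω hω

/-- All transmitted numbers are at most n^κ, and a pair of such numbers lies below (n^κ + 1)² ≤
n^(2κ+2), where 2 ≤ n is needed. -/
theorem TesterData.fits {V : Type} [Fintype V] {ident : V → ℕ} {κ b : ℕ} (hκ : 1 ≤ κ)
    (hid : IsIdAssignment κ ident) (hn : 2 ≤ Fintype.card V) (hb : 2 * κ + 2 ≤ b) :
    TesterData.Fits ident (b * Nat.clog 2 (Fintype.card V)) := by
  set n := Fintype.card V
  have h1 : n ^ κ + 1 ≤ n ^ (κ + 1) := by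
    have : 1 ≤ n ^ κ := Nat.one_le_pow _ _ (by omega)
    rw [pow_succ]
    nlinarith
  have h2 : n ≤ n ^ κ := Nat.le_self_pow (by omega) n
  have h3 : (n ^ κ + 1) ^ 2 ≤ n ^ (2 * κ + 2) := by
    rw [show 2 * κ + 2 = (κ + 1) * 2 by ring, pow_mul]
    exact Nat.pow_le_pow_left h1 2
  have hone : ∀ m ≤ n ^ κ, m.size ≤ b * Nat.clog 2 n := fun m hm =>
    size_le_mul_clog (e := 2 * κ + 2) (by nlinarith) hb
  have hpair : ∀ a ≤ n ^ κ, ∀ m ≤ n ^ κ, (Nat.pair a m).size ≤ b * Nat.clog 2 n := by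
    intro a ha m hm
    refine size_le_mul_clog (e := 2 * κ + 2) (lt_of_lt_of_le (Nat.pair_lt_max_add_one_sq a m) ?_) hb
    exact (Nat.pow_le_pow_left (by have := max_le ha hm; omega) 2).trans h3
  exact ⟨fun v => hone _ (hid.2 v), fun m hm => hone _ (hm.trans h2),
    fun a ha m hm => hpair _ (ha.trans h2) _ (hm.trans h2),
    fun v m hm => hpair _ (hid.2 v) _ (hm.trans h2)⟩

/-- `A` verifies `P` with messages of `B ⌈log₂ n⌉` bits in `r (diam G + 1)` rounds. -/
def DistAlgorithm.Verifies (A : DistAlgorithm) (κ : ℕ) (P : GraphProperty) (B r : ℕ) : Prop :=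
  ∀ (V : Type) [Fintype V] (G : SimpleGraph V) (ident : V → ℕ),
    G.Connected → IsIdAssignment κ ident →
      A.RespectsBandwidth B G ident ∧ A.HaltsWithin (r * (G.diam + 1)) G ident ∧
      ∀ ω : A.Coins V, (∀ v, A.Outputs G ident ω v true) ↔ P.Holds G

namespace TesterData

variable {d : TesterData} {κ : ℕ} {P : GraphProperty} {B r : ℕ} {V : Type} [Fintype V]
  {G : SimpleGraph V} {ident : V → ℕ} {ω : V → Fin (d.coins (Fintype.card V)) → Bool}
  {c l s a : V → ℕ} {par : V → Option V}

/-- All processors of a cluster accept if and only if the cluster has the property. -/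
theorem Clustered.accept_iff (S : Clustered d G ident ω c par l s a) (hκ : 1 ≤ κ)
    (hver : d.ver.Verifies κ P B r) (hB : B * Nat.clog 2 (Fintype.card V) ≤ d.width (Fintype.card V))
    (hR : d.R (Fintype.card V) = r * (2 * d.L (Fintype.card V) + 1))
    (hskip : d.skip (Fintype.card V) = none) (k : V) :
    (∀ v, c v = c k → d.protocol.toAlgorithm.Outputs G ident ω v true) ↔
      P.Holds (G.induce {u | c u = c k}) := by
  classical
  -- In a cluster with m vertices the preorder numbers are below m ≤ m^κ; the original IDs need not
  -- satisfy this bound.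
  have hid : IsIdAssignment κ (fun u : {u | c u = c k} => a u) := by
    refine ⟨fun u u' h => Subtype.ext (S.label_injOn (u.2.trans u'.2.symm) h), fun u => ?_⟩
    have hu : c u = c k := u.2
    have h := S.label_lt u
    have hle := Nat.le_self_pow (show κ ≠ 0 by omega) (Fintype.card {v | c v = c k})
    have he : Fintype.card {v | c v = c u} = Fintype.card {v | c v = c k} := by simp only [hu]
    simp only
    omega
  obtain ⟨h1, h2, h3⟩ := hver {u | c u = c k} (G.induce {u | c u = c k}) (fun u => a u)
    (S.clustering.connected k) hid
  -- The verifier is correct for every outcome of its coins, so it can be run with all of them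
  -- fixed.
  rw [← h3 fun _ _ => false]
  have hcard : Fintype.card {u | c u = c k} ≤ Fintype.card V := Fintype.card_subtype_le _
  have hw : B * Nat.clog 2 (Fintype.card {u | c u = c k}) ≤ d.width (Fintype.card V) :=
    (Nat.mul_le_mul_left B (Nat.clog_mono_right 2 hcard)).trans hB
  have hdur : d.protocol.dur (Fintype.card V) =
      3 * d.L (Fintype.card V) + 1 + d.R (Fintype.card V) := by simp [protocol, hskip]
  have key : ∀ v : {u | c u = c k}, d.protocol.toAlgorithm.Outputs G ident ω v true ↔
      d.ver.Outputs (G.induce {u | c u = c k}) (fun u => a u) (fun _ _ => false) v true := by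
    intro v
    have hle : r * ((G.induce {u | c u = c k}).diam + 1) ≤ d.R (Fintype.card V) := by
      rw [hR]
      have := S.clustering.diam_le k
      gcongr
    have hsome : (d.ver.verdict (G.induce {u | c u = c k}) (fun u => a u) (fun _ _ => false)
        (d.R (Fintype.card V)) v).isSome := by
      obtain ⟨b, hb⟩ := Option.isSome_iff_exists.1 (h2 (fun _ _ => false) v)
      rw [d.ver.verdict_of_le _ hb hle]
      rfl
    refine (d.protocol.outputs_iff (G := G) (ident := ident) ω v true).trans ?_
    rw [d.ver.outputs_iff _ hsome, hdur, DistAlgorithm.verdict, ← S.nodeAt_inner_eq (c k) h1 hw]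
    simp [protocol, hskip, nodeAt]
  exact ⟨fun h v => (key v).1 (h v v.2), fun h v hv => (key ⟨v, hv⟩).2 (h ⟨v, hv⟩)⟩

end TesterData

/-! ### The tester -/

/-- A bound on the random shifts, up to a constant. -/
def shiftBound (k n : ℕ) : ℕ := 2 ^ k * (Nat.clog 2 n + 3)

/-- A geometric random variable, computed from fair coins. -/
noncomputable def shift (k K : ℕ) : (Fin (k * K) → Bool) → ℕ := (exists_geometric_coins k K).choose

open Classical in
/-- The tester for `P` with a verifier `A`, for networks in which an `ε`-fraction of the edges may
be cut. -/
noncomputable def testerData (A : DistAlgorithm) (P : GraphProperty) (b r : ℕ) (ε : ℝ) (k : ℕ) :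
    TesterData where
  ver := A
  coins n := k * (shiftBound k n + 3)
  start n ω := shiftBound k n + 3 - shift k (shiftBound k n + 3) ω
  L n := shiftBound k n + 4
  R n := r * (2 * (shiftBound k n + 4) + 1)
  width n := b * Nat.clog 2 n
  skip n := if n ≤ 1 ∨ 1 < ε then some (decide (P.Holds (⊥ : SimpleGraph (Fin n)))) else none

theorem testerData_start_lt (A : DistAlgorithm) (P : GraphProperty) (b r : ℕ) (ε : ℝ) (k n : ℕ)
    (ω : Fin ((testerData A P b r ε k).coins n) → Bool) :
    (testerData A P b r ε k).start n ω < (testerData A P b r ε k).L n :=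
  Nat.lt_succ_of_le (Nat.sub_le _ _)

/-- 36/ε is rounded up to a power of two. The upper bound serves the round count, which matters only
for ε ≤ 1; otherwise 2⁶ ≥ 36 suffices. -/
theorem exists_shift_parameter {ε : ℝ} (hε : 0 < ε) :
    ∃ k : ℕ, 36 ≤ ε * 2 ^ k ∧ (ε ≤ 1 → ε * 2 ^ k ≤ 72) := by
  rcases le_or_gt ε 1 with h | h
  · obtain ⟨m, h1, h2⟩ := exists_nat_pow_near (x := 36 / ε) (y := 2)
      (by rw [le_div_iff₀ hε]; linarith) one_lt_two
    rw [le_div_iff₀ hε] at h1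
    rw [div_lt_iff₀ hε] at h2
    refine ⟨m + 1, by linarith, fun _ => ?_⟩
    rw [pow_succ]
    linarith
  · exact ⟨6, by norm_num; linarith, fun h' => absurd h (not_lt.2 h')⟩

/-- clog n + 3 ≤ log₂ n + 4 ≤ 5 log₂ n, and 5 / log 2 < 8. -/
theorem clog_add_three_le {n : ℕ} (hn : 2 ≤ n) : (Nat.clog 2 n : ℝ) + 3 ≤ 8 * Real.log n := by
  have h2 := Real.log_two_gt_d9
  have hlog : Real.log 2 ≤ Real.log n := Real.log_le_log (by norm_num) (by exact_mod_cast hn)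
  have hpos : 0 < Nat.clog 2 n := Nat.clog_pos one_lt_two hn
  have h := Nat.pow_pred_clog_lt_self one_lt_two hn
  obtain ⟨m, hm⟩ : ∃ m, Nat.clog 2 n = m + 1 := ⟨Nat.clog 2 n - 1, by omega⟩
  rw [hm] at h ⊢
  have h3 : ((2 : ℝ) ^ m) ≤ n := by exact_mod_cast h.le
  have h4 := Real.log_le_log (by positivity) h3
  rw [Real.log_pow] at h4
  push_cast
  nlinarith

theorem rounds_le {ε : ℝ} (hε : 0 < ε) (hε1 : ε ≤ 1) {k n : ℕ} (hn : 2 ≤ n)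
    (hk : ε * 2 ^ k ≤ 72) (r : ℕ) :
    ((3 * (shiftBound k n + 4) + 1 + r * (2 * (shiftBound k n + 4) + 1) : ℕ) : ℝ) ≤
      2000 * (r + 1) * Real.log n / ε := by
  have h2 := Real.log_two_gt_d9
  have hlog : Real.log 2 ≤ Real.log n := Real.log_le_log (by norm_num) (by exact_mod_cast hn)
  have hc := clog_add_three_le hn
  set y := Real.log n with hy
  have hS : ε * (shiftBound k n : ℝ) ≤ 576 * y := by
    have : (shiftBound k n : ℝ) = 2 ^ k * (Nat.clog 2 n + 3) := by simp [shiftBound]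
    rw [this, ← mul_assoc]
    calc ε * 2 ^ k * ((Nat.clog 2 n : ℝ) + 3) ≤ 72 * (8 * y) := by gcongr
      _ = 576 * y := by ring
  rw [le_div_iff₀ hε]
  push_cast
  -- Since log 2 > 1/2, additive constants are absorbed: 2 · 576 + 9 · 2 = 1170 and 3 · 576 + 13 · 2
  -- = 1754.
  have hone : ε ≤ 2 * y := by linarith
  have hr : (0 : ℝ) ≤ r := by positivity
  have e1 : (2 * ((shiftBound k n : ℝ) + 4) + 1) * ε ≤ 1170 * y := by nlinarith
  have e2 : (3 * ((shiftBound k n : ℝ) + 4) + 1) * ε ≤ 1754 * y := by nlinarith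
  have e3 := mul_le_mul_of_nonneg_left e1 hr
  have e4 : 0 ≤ r * y := mul_nonneg hr (by linarith)
  nlinarith

section Tester

variable {A : DistAlgorithm} {P : GraphProperty} {B r κ k : ℕ} {ε : ℝ}

/-- If few edges are cut, then some processor rejects. -/
theorem exists_reject_of_hasGap (hκ : 1 ≤ κ) (hnd : P.NonDisjointed)
    (hver : A.Verifies κ P B r) {V : Type} [Fintype V] [Nonempty V] {G : SimpleGraph V}
    {ident : V → ℕ} (hid : IsIdAssignment κ ident) (hn : 2 ≤ Fintype.card V) (hε : ε ≤ 1)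
    (hfar : P.IsFar ε G)
    (ω : (testerData A P (B + (2 * κ + 2)) r ε k).protocol.toAlgorithm.Coins V)
    (h : G.edgeSet = ∅ ∨
      (∀ v, shift k (shiftBound k (Fintype.card V) + 3) (ω v) <
        shiftBound k (Fintype.card V) + 3) ∧
      (({e ∈ G.edgeSet | ¬ HasGap
        (cappedDist G (shiftBound k (Fintype.card V) + 3) e.out.1)
        (shift k (shiftBound k (Fintype.card V) + 3) ∘ ω)}.ncard : ℕ) : ℝ) <
          ε * G.edgeSet.ncard) :
    ∃ v, (testerData A P (B + (2 * κ + 2)) r ε k).protocol.toAlgorithm.Outputs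
      G ident ω v false := by
  have hskip : (testerData A P (B + (2 * κ + 2)) r ε k).skip (Fintype.card V) = none :=
    if_neg (by rw [not_or]; constructor <;> linarith)
  obtain ⟨c, par, l, s, a, S⟩ := TesterData.exists_clustered
    (d := testerData A P (B + (2 * κ + 2)) r ε k) (G := G) (ω := ω) hid.1
    (TesterData.fits hκ hid hn (by omega)) (fun v => testerData_start_lt _ _ _ _ _ _ _ _)
  have hnot : ¬ P.Holds (withinClusters G c) := by
    -- Without edges the strict inequality would read 0 < 0, so this case is separate; nothing is
    -- cut there.
    rcases h with h | ⟨hlt, h⟩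
    · have : withinClusters G c = G := by
        rw [SimpleGraph.edgeSet_eq_empty] at h
        subst h
        ext u v
        simp [withinClusters]
      rw [this]
      exact hfar.1
    · refine hfar.not_holds_withinClusters c _ ?_ h
      intro u v huv hc
      refine ⟨huv, fun hg => hc ?_⟩
      -- A cut edge is charged to one chosen endpoint. A gap at either end would put both ends in
      -- one cluster.
      have hmem : (s(u, v)).out.1 ∈ s(u, v) := Sym2.out_fst_mem _
      rcases Sym2.mem_iff.1 hmem with h1 | h1
      · rw [h1] at hg
        exact S.clustering.center_eq_of_hasGap hlt huv hg
      · rw [h1] at hg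
        exact (S.clustering.center_eq_of_hasGap hlt huv.symm hg).symm
  obtain ⟨w, hw⟩ := hnd.exists_cluster c hnot
  rw [← S.accept_iff hκ hver (Nat.mul_le_mul_right _ (by omega)) rfl hskip w] at hw
  push Not at hw
  obtain ⟨v, -, hv⟩ := hw
  refine ⟨v, ?_⟩
  rw [Protocol.outputs_iff] at hv ⊢
  simpa using hv

theorem isOneSidedTester (hκ : 1 ≤ κ) (hmono : P.EdgeMonotone) (hnd : P.NonDisjointed)
    (hver : A.Verifies κ P B r) (hε : 0 < ε) (hk : 36 ≤ ε * 2 ^ k) (hk' : ε ≤ 1 → ε * 2 ^ k ≤ 72) :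
    IsOneSidedTester κ P ε (B + (2 * κ + 2)) (fun n => 2000 * (r + 1) * Real.log n / ε)
      (testerData A P (B + (2 * κ + 2)) r ε k).protocol.toAlgorithm := by
  classical
  set d := testerData A P (B + (2 * κ + 2)) r ε k with hd
  have hskip : ∀ n, n ≤ 1 ∨ 1 < ε →
      d.skip n = some (decide (P.Holds (⊥ : SimpleGraph (Fin n)))) := fun n h => if_pos h
  have hskip' : ∀ n, ¬ (n ≤ 1 ∨ 1 < ε) → d.skip n = none := fun n h => if_neg h
  refine ⟨fun V _ G ident _ => Protocol.respectsBandwidth _ _ rfl, ?_, ?_, ?_⟩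
  · intro V _ _ G ident _
    refine ⟨_, ?_, Protocol.haltsWithin_dur _⟩
    have hdur : d.protocol.dur (Fintype.card V) = if (d.skip (Fintype.card V)).isSome then 0
      else 3 * (shiftBound k (Fintype.card V) + 4) + 1 +
        r * (2 * (shiftBound k (Fintype.card V) + 4) + 1) := rfl
    rw [hdur]
    by_cases hs : Fintype.card V ≤ 1 ∨ 1 < ε
    · rw [hskip _ hs]
      have : 0 ≤ Real.log (Fintype.card V) := Real.log_natCast_nonneg _
      simp only [Option.isSome_some, if_true, Nat.cast_zero]
      positivity
    · rw [hskip' _ hs]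
      push Not at hs
      simpa using rounds_le hε hs.2 hs.1 (hk' hs.2) r
  · intro V _ G ident hid hG ω v
    by_cases hs : Fintype.card V ≤ 1 ∨ 1 < ε
    · rw [Protocol.outputs_iff]
      have : P.Holds (⊥ : SimpleGraph (Fin (Fintype.card V))) :=
        GraphProperty.holds_bot_iff.2 (hmono V G ⊥ bot_le hG)
      simp [TesterData.protocol, hskip _ hs, this]
    -- No event is excluded here: truncated subtraction keeps every start time below `L` even if a
    -- shift is too large, so a clustering exists for all coin outcomes.
    · obtain ⟨c, par, l, s, a, S⟩ := TesterData.exists_clustered (d := d) (G := G) (ω := ω) hid.1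
        (TesterData.fits hκ hid (by omega) (by omega))
        (fun v => testerData_start_lt _ _ _ _ _ _ _ _)
      exact (S.accept_iff hκ hver (Nat.mul_le_mul_right _ (by omega)) rfl (hskip' _ hs) v).2
        (hnd.holds_induce hG _ ⟨v, rfl⟩) v rfl
  · intro V _ _ G ident hid hfar
    by_cases hs : Fintype.card V ≤ 1 ∨ 1 < ε
    · refine DistAlgorithm.le_rejectProb _ G ident _ univ ?_ fun ω _ => ?_
      · rw [Finset.card_univ]
        have : (0 : ℝ) ≤ Fintype.card (d.protocol.toAlgorithm.Coins V) := by positivity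
        linarith
      · obtain ⟨v⟩ := ‹Nonempty V›
        refine ⟨v, ?_⟩
        rw [Protocol.outputs_iff]
        have : ¬ P.Holds (⊥ : SimpleGraph (Fin (Fintype.card V))) := fun h =>
          hfar.not_holds_bot hs (GraphProperty.holds_bot_iff.1 h)
        simp [TesterData.protocol, hskip _ hs, this]
    · push Not at hs
      rcases G.edgeSet.eq_empty_or_nonempty with hE | hE
      · refine DistAlgorithm.le_rejectProb _ G ident _ univ ?_ fun ω _ =>
          exists_reject_of_hasGap hκ hnd hver hid hs.1 hs.2 hfar ω (.inl hE)
        rw [Finset.card_univ]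
        have : (0 : ℝ) ≤ Fintype.card (d.protocol.toAlgorithm.Coins V) := by positivity
        linarith
      · have hcount := two_thirds_le_card_shifts (V := V) ε k
          (shiftBound k (Fintype.card V)) hk rfl
          (A := Fin (k * (shiftBound k (Fintype.card V) + 3)) → Bool) (by simp)
          (shift k (shiftBound k (Fintype.card V) + 3))
          (exists_geometric_coins k (shiftBound k (Fintype.card V) + 3)).choose_spec
          G.edgeFinset (by simpa using hE)
          (fun e => cappedDist G (shiftBound k (Fintype.card V) + 3) e.out.1)
        refine DistAlgorithm.le_rejectProb _ G ident _ _ hcount fun ω hω =>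
          exists_reject_of_hasGap hκ hnd hver hid hs.1 hs.2 hfar ω (.inr ?_)
        obtain ⟨h1, h2⟩ := (Finset.mem_filter.1 hω).2
        refine ⟨h1, ?_⟩
        rw [show G.edgeSet.ncard = G.edgeFinset.card by
          rw [← SimpleGraph.coe_edgeFinset, Set.ncard_coe_finset]]
        refine lt_of_le_of_lt ?_ h2
        rw [Nat.cast_le, ← Set.ncard_coe_finset]
        exact Set.ncard_le_ncard (fun e he => by simpa using he) (Set.toFinite _)

end Tester

theorem mainTheorem1 (κ : ℕ) (hκ : 1 ≤ κ) (P : GraphProperty)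
    (hmono : P.EdgeMonotone) (hnd : P.NonDisjointed)
    (hver : VerifiableInDiameterRounds κ P) :
    ∃ (C : ℝ) (B : ℕ), ∀ ε : ℝ, 0 < ε →
      ∃ A : DistAlgorithm,
        IsOneSidedTester κ P ε B (fun n => C * Real.log n / ε) A := by
  obtain ⟨A, B, r, h⟩ := hver
  refine ⟨2000 * (r + 1), B + (2 * κ + 2), fun ε hε => ?_⟩
  obtain ⟨k, hk, hk'⟩ := exists_shift_parameter hε
  exact ⟨_, isOneSidedTester hκ hmono hnd h hε hk hk'⟩
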